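/- Let $B=(B_t)_{t\in[0,1]}$ be a standard Brownian motion on a probability space $(\Omega,\mathcal F,\mathbb P)$, where $\mathcal F$ is the $\sigma$-field generated by $B$ up to null sets, and let $\mathcal F_t$ be generated by $(B_s)_{s\le t}$ and the $\mathbb P$-null sets. Let $\mathcal H=L^2(0,1)$ and let $W:\mathcal H\to L^2(\Omega)$, $W(h)=\int_0^1 h(s)\,dB_s$, be the Wiener integral, i.e. the linear isometry with $W(\mathbf 1_{[0,t]})=B_t$. The Malliavin derivative $D:\mathbb D^{1,2}\subset L^2(\Omega)\to L^2(\Omega;\mathcal H)$ is the closure of the operator $$p(W(h_1),\dots,W(h_m))\mapsto \sum_{i=1}^m \partial_i p(W(h_1),\dots,W(h_m))\,h_i$$ ($m\ge 0$, $p$ a real polynomial in $m$ variables, $h_i\in\mathcal H$), and the divergence (Skorokhod integral) $\delta:\mathrm{Dom}(\delta)\subset L^2(\Omega;\mathcal H)\to L^2(\Omega)$ is the adjoint of $D$. Identify $L^2(\Omega\times(0,1))$ with $L^2(\Omega;\mathcal H)$ through $u\mapsto(\omega\mapsto u(\omega,\cdot))$, and let $L^2_a\subset L^2(\Omega\times(0,1))$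 be the subspace of (classes of) $(\mathcal F_t)$-adapted processes. For elementary adapted processes $u=\sum_{k=1}^N Y_k\mathbf 1_{[s_k,t_k)}$, with $0\le s_k<t_k\le 1$ and $Y_k$ square-integrable and $\mathcal F_{s_k}$-measurable, the Itô integral is $\sum_{k=1}^N Y_k(B_{t_k}-B_{s_k})$; for $u\in L^2_a$ the Itô integral $\int_0^1u(t)\,dB_t$ is the $L^2(\Omega)$-limit of the integrals of elementary adapted processes that converge to $u$ in $L^2(\Omega\times(0,1))$. **Proposition.** $L^2_a\subset \mathrm{Dom}(\delta)$, and for every $u\in L^2_a$ the Itô integral of $u$ exists, is unique, and equals $\delta(u)$. -/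

import Mathlib

open MeasureTheory ProbabilityTheory Filter Topology
open scoped unitInterval ENNReal

noncomputable section

namespace Skorokhod

/-! ### Brownian motion on `[0,1]`, its filtration and the Wiener integral -/

/-- A standard (real) Brownian motion `(B_t)_{t ∈ [0,1]}` on `(Ω, 𝓕, P)`. -/
structure IsBrownianMotion {Ω : Type*} [MeasurableSpace Ω] (B : I → Ω → ℝ) (P : Measure Ω) :
    Prop where
  measurable : ∀ t, Measurable (B t)
  eval_zero : ∀ᵐ ω ∂P, B 0 ω = 0
  hasIndepIncrements : HasIndepIncrements B P
  hasLaw_sub : ∀ s t : I, s ≤ t →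
    HasLaw (fun ω ↦ B t ω - B s ω) (gaussianReal 0 (Real.toNNReal ((t : ℝ) - (s : ℝ)))) P
  continuous_paths : ∀ᵐ ω ∂P, Continuous fun t ↦ B t ω

theorem IsBrownianMotion.memLp {Ω : Type*} [MeasurableSpace Ω] {B : I → Ω → ℝ} {P : Measure Ω}
    (hB : IsBrownianMotion B P) (t : I) : MemLp (B t) 2 P := by
  have h := (hB.hasLaw_sub 0 t t.2.1).hasGaussianLaw.memLp_two
  refine h.ae_eq ?_
  filter_upwards [hB.eval_zero] with ω hω
  simp [hω]

/-- The filtration generated by `B`, completed by the null sets: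
`𝓕_t = σ(B_s, s ≤ t) ∨ {N : P N = 0}`. -/
def brownianFiltration {Ω : Type*} [mΩ : MeasurableSpace Ω] {B : I → Ω → ℝ} {P : Measure Ω}
    (hB : IsBrownianMotion B P) : Filtration I mΩ where
  seq t := (⨆ s ≤ t, MeasurableSpace.comap (B s) inferInstance) ⊔
    MeasurableSpace.generateFrom {N | MeasurableSet N ∧ P N = 0}
  mono' _ _ hst := sup_le_sup_right (biSup_mono fun _ hr ↦ hr.trans hst) _
  le' _ := sup_le (iSup₂_le fun s _ ↦ (hB.measurable s).comap_le)
    (MeasurableSpace.generateFrom_le fun _ hN ↦ hN.1)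

/-- The Hilbert space `L²(0,1)`. -/
abbrev L2Time : Type := Lp ℝ 2 (volume : Measure I)

/-- The indicator function of `[0,t]` in `L²(0,1)`. -/
def indicatorTime (t : I) : L2Time :=
  indicatorConstLp 2 (measurableSet_Iic : MeasurableSet (Set.Iic t)) (measure_ne_top _ _) (1 : ℝ)

/-- The Wiener integral `W : L²(0,1) → L²(Ω)`, `W h = ∫₀¹ h(s) dB_s`: the continuous extension of
the isometric map `∑ᵢ aᵢ 1_{[0,tᵢ]} ↦ ∑ᵢ aᵢ B_{tᵢ}`, defined on the dense subspace of linear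
combinations of the indicator functions `1_{[0,t]}`. -/
def wienerIntegral {Ω : Type*} [MeasurableSpace Ω] {B : I → Ω → ℝ} {P : Measure Ω}
    (hB : IsBrownianMotion B P) : L2Time →L[ℝ] Lp ℝ 2 P :=
  (Finsupp.linearCombination ℝ fun t : I ↦ (hB.memLp t).toLp).extendOfNorm
    (Finsupp.linearCombination ℝ indicatorTime)

/-! ### Malliavin derivative and divergence

Here `H` is a separable Hilbert space and `W : H → L²(Ω)` an isometry whose range is the Gaussian
Hilbert space. -/

section Malliavin

variable {Ω : Type*} [MeasurableSpace Ω] {P : Measure Ω}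
  {H : Type*} [NormedAddCommGroup H] [InnerProductSpace ℝ H]

/-- `F = p(W(h₁), …, W(hₘ))` and `G = ∑ᵢ ∂ᵢp(W(h₁), …, W(hₘ)) hᵢ` for some polynomial `p` in `m`
real variables and some `h₁, …, hₘ ∈ H`. -/
def IsPolynomialWithDerivative (W : H →L[ℝ] Lp ℝ 2 P) (F : Lp ℝ 2 P) (G : Lp H 2 P) : Prop :=
  ∃ (m : ℕ) (p : MvPolynomial (Fin m) ℝ) (h : Fin m → H),
    (∀ᵐ ω ∂P, F ω = MvPolynomial.eval (fun i ↦ W (h i) ω) p) ∧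
    (∀ᵐ ω ∂P, G ω =
      ∑ i, MvPolynomial.eval (fun j ↦ W (h j) ω) (MvPolynomial.pderiv i p) • h i)

/-- The derivative operator on polynomial random variables, as the operator
`L²(Ω) → L²(Ω; H)` with domain `𝒫(H₁)` whose graph consists of the pairs `(F, DF)`. (These pairs
form a linear space, so that the linear span does not add anything.) -/
def malliavinPolynomial (W : H →L[ℝ] Lp ℝ 2 P) : Lp ℝ 2 P →ₗ.[ℝ] Lp H 2 P :=
  (Submodule.span ℝ {x : Lp ℝ 2 P × Lp H 2 P |
    IsPolynomialWithDerivative W x.1 x.2}).toLinearPMap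

/-- The Malliavin derivative `D : 𝔻^{1,2} ⊂ L²(Ω) → L²(Ω; H)`: the closure of the derivative
operator on polynomial random variables. -/
def malliavinDerivative (W : H →L[ℝ] Lp ℝ 2 P) : Lp ℝ 2 P →ₗ.[ℝ] Lp H 2 P :=
  (malliavinPolynomial W).closure

/-- The divergence operator `δ : Dom(δ) ⊂ L²(Ω; H) → L²(Ω)`: the adjoint of the Malliavin
derivative. -/
def divergence (W : H →L[ℝ] Lp ℝ 2 P) : Lp H 2 P →ₗ.[ℝ] Lp ℝ 2 P :=
  (malliavinDerivative W).adjoint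

end Malliavin

/-! ### The identification `L²(Ω × (0,1)) ≃ L²(Ω; L²(0,1))` -/

section Identification

variable {Ω : Type*} [MeasurableSpace Ω] {P : Measure Ω} [IsProbabilityMeasure P]

open scoped Classical in
/-- The path `t ↦ u(ω, t)` as an element of `L²(0,1)` (zero for the negligible set of those `ω`
for which the path is not square-integrable). -/
def pathL2 (u : Ω × I → ℝ) (ω : Ω) : L2Time :=
  if h : MemLp (fun t ↦ u (ω, t)) 2 (volume : Measure I) then h.toLp else 0

theorem ae_memLp_path (u : Lp ℝ 2 (P.prod (volume : Measure I))) :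
    ∀ᵐ ω ∂P, MemLp (fun t ↦ u (ω, t)) 2 (volume : Measure I) := by
  have hu := (Lp.stronglyMeasurable u)
  have h2 := (Lp.memLp u).integrable_sq
  filter_upwards [h2.prod_right_ae] with ω hω
  exact (memLp_two_iff_integrable_sq
    (hu.comp_measurable measurable_prodMk_left).aestronglyMeasurable).2 hω

theorem measurable_eLpNorm_path {u : Ω × I → ℝ} (hu : StronglyMeasurable u) (c : I → ℝ)
    (hc : StronglyMeasurable c) :
    Measurable fun ω ↦ eLpNorm (fun t ↦ u (ω, t) - c t) 2 (volume : Measure I) := by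
  simp only [eLpNorm_eq_lintegral_rpow_enorm_toReal (two_ne_zero) (ENNReal.ofNat_ne_top)]
  refine Measurable.pow_const (Measurable.lintegral_prod_right ?_) _
  have h1 : Measurable u := hu.measurable
  have h2 : Measurable c := hc.measurable
  fun_prop

theorem stronglyMeasurable_pathL2 {u : Ω × I → ℝ} (hu : StronglyMeasurable u) :
    StronglyMeasurable (pathL2 u) := by
  borelize L2Time
  have : Fact ((2 : ℝ≥0∞) ≠ ∞) := ⟨ENNReal.ofNat_ne_top⟩
  have hbasis : TopologicalSpace.IsTopologicalBasis
      {s : Set L2Time | ∃ (c : L2Time) (r : ℝ≥0∞), s = Metric.eball c r} := by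
    refine TopologicalSpace.isTopologicalBasis_of_isOpen_of_nhds ?_ ?_
    · rintro _ ⟨c, r, rfl⟩
      exact Metric.isOpen_eball
    · intro a s ha hs
      obtain ⟨r, hr, hrs⟩ := EMetric.isOpen_iff.1 hs a ha
      exact ⟨_, ⟨a, r, rfl⟩, Metric.mem_eball_self hr, hrs⟩
  refine Measurable.stronglyMeasurable ?_
  rw [BorelSpace.measurable_eq (α := L2Time), hbasis.borel_eq_generateFrom]
  refine measurable_generateFrom ?_
  rintro _ ⟨c, r, rfl⟩
  have hpath : ∀ ω, StronglyMeasurable fun t ↦ u (ω, t) := fun ω ↦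
    hu.comp_measurable measurable_prodMk_left
  have hM : MeasurableSet {ω | MemLp (fun t ↦ u (ω, t)) 2 (volume : Measure I)} := by
    have h0 := measurable_eLpNorm_path hu 0 stronglyMeasurable_zero
    simp only [Pi.zero_apply, sub_zero] at h0
    simpa only [MemLp, (hpath _).aestronglyMeasurable, true_and] using
      measurableSet_lt h0 measurable_const
  have hEq : pathL2 u ⁻¹' Metric.eball c r =
      ({ω | MemLp (fun t ↦ u (ω, t)) 2 (volume : Measure I)} ∩
        {ω | eLpNorm (fun t ↦ u (ω, t) - c t) 2 (volume : Measure I) < r}) ∪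
      ({ω | MemLp (fun t ↦ u (ω, t)) 2 (volume : Measure I)}ᶜ ∩ {_ω | edist 0 c < r}) := by
    ext ω
    by_cases h : MemLp (fun t ↦ u (ω, t)) 2 (volume : Measure I)
    · have : edist (h.toLp (fun t ↦ u (ω, t))) c =
          eLpNorm (fun t ↦ u (ω, t) - c t) 2 (volume : Measure I) := by
        rw [Lp.edist_def]
        refine eLpNorm_congr_ae ?_
        filter_upwards [h.coeFn_toLp] with t ht
        simp [ht]
      simp [pathL2, h, this]
    · simp [pathL2, h]
  rw [hEq]
  refine (hM.inter ?_).union (hM.compl.inter (MeasurableSet.const _))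
  exact measurable_eLpNorm_path hu c (Lp.stronglyMeasurable c) measurableSet_Iio

theorem memLp_pathL2 (u : Lp ℝ 2 (P.prod (volume : Measure I))) : MemLp (pathL2 u) 2 P := by
  have hu := Lp.stronglyMeasurable u
  refine ⟨(stronglyMeasurable_pathL2 hu).aestronglyMeasurable, ?_⟩
  have h1 : ∫⁻ ω, ‖pathL2 u ω‖ₑ ^ (2 : ℝ) ∂P =
      ∫⁻ z, ‖u z‖ₑ ^ (2 : ℝ) ∂(P.prod (volume : Measure I)) := by
    rw [lintegral_prod _ (hu.enorm.pow_const _).aemeasurable]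
    refine lintegral_congr_ae ?_
    filter_upwards [ae_memLp_path u] with ω hω
    simp only [pathL2, hω, dif_pos, Lp.enorm_toLp]
    rw [eLpNorm_eq_lintegral_rpow_enorm_toReal two_ne_zero ENNReal.ofNat_ne_top,
      ← ENNReal.rpow_mul]
    simp
  have h2 := (Lp.memLp u).2
  rw [eLpNorm_lt_top_iff_lintegral_rpow_enorm_lt_top two_ne_zero ENNReal.ofNat_ne_top] at h2 ⊢
  simp only [ENNReal.toReal_ofNat] at h2 ⊢
  rwa [h1]

/-- The identification `L²(Ω × (0,1)) → L²(Ω; L²(0,1))` that sends `u` to the random variable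
`ω ↦ u(ω, ·)`. -/
def toHilbertValued (u : Lp ℝ 2 (P.prod (volume : Measure I))) : Lp L2Time 2 P :=
  (memLp_pathL2 u).toLp

theorem toHilbertValued_ae (u : Lp ℝ 2 (P.prod (volume : Measure I))) :
    ∀ᵐ ω ∂P, toHilbertValued u ω =ᵐ[volume] fun t ↦ u (ω, t) := by
  filter_upwards [(memLp_pathL2 u).coeFn_toLp, ae_memLp_path u] with ω h1 h2
  rw [toHilbertValued, h1, pathL2, dif_pos h2]
  exact h2.coeFn_toLp

end Identification

/-! ### Adapted processes and the Itô integral -/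

section Ito

variable {Ω : Type*} [mΩ : MeasurableSpace Ω] {B : I → Ω → ℝ} {P : Measure Ω}
  [IsProbabilityMeasure P]

/-- `L²_a`: the subspace of `L²(Ω × (0,1))` of the (classes of) adapted processes. -/
def adaptedL2 (hB : IsBrownianMotion B P) :
    Submodule ℝ (Lp ℝ 2 (P.prod (volume : Measure I))) where
  carrier := {u | ∃ v : I → Ω → ℝ, StronglyAdapted (brownianFiltration hB) v ∧
    ∀ᵐ z ∂(P.prod (volume : Measure I)), u z = v z.2 z.1}
  zero_mem' := ⟨0, fun _ ↦ stronglyMeasurable_zero, by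
    filter_upwards [Lp.coeFn_zero ℝ 2 (P.prod (volume : Measure I))] with z hz
    rw [hz]
    rfl⟩
  add_mem' := by
    rintro u₁ u₂ ⟨v₁, h₁, e₁⟩ ⟨v₂, h₂, e₂⟩
    refine ⟨v₁ + v₂, fun t ↦ (h₁ t).add (h₂ t), ?_⟩
    filter_upwards [Lp.coeFn_add u₁ u₂, e₁, e₂] with z hz hz₁ hz₂
    rw [hz, Pi.add_apply, hz₁, hz₂]
    rfl
  smul_mem' := by
    rintro c u ⟨v, h, e⟩
    refine ⟨c • v, fun t ↦ (h t).const_smul c, ?_⟩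
    filter_upwards [Lp.coeFn_smul c u, e] with z hz hz₁
    rw [hz, Pi.smul_apply, hz₁]
    rfl

/-- `u = ∑ₖ Yₖ 1_{[sₖ,tₖ)}` is an elementary adapted process, with `Yₖ` square-integrable and
`𝓕_{sₖ}`-measurable, and `X = ∑ₖ Yₖ (B_{tₖ} - B_{sₖ})`. -/
def IsElementaryIto (hB : IsBrownianMotion B P) (u : Lp ℝ 2 (P.prod (volume : Measure I)))
    (X : Lp ℝ 2 P) : Prop :=
  ∃ (N : ℕ) (s t : Fin N → I) (Y : Fin N → Ω → ℝ),
    (∀ k, s k < t k) ∧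
    (∀ k, StronglyMeasurable[brownianFiltration hB (s k)] (Y k)) ∧
    (∀ k, MemLp (Y k) 2 P) ∧
    (∀ᵐ z ∂(P.prod (volume : Measure I)),
      u z = ∑ k, Y k z.1 * (Set.Ico (s k) (t k)).indicator 1 z.2) ∧
    (∀ᵐ ω ∂P, X ω = ∑ k, Y k ω * (B (t k) ω - B (s k) ω))

/-- `X` is the Itô integral `∫₀¹ u(t) dB_t`: the limit in `L²(Ω)` of the integrals of elementary
adapted processes that converge to `u` in `L²(Ω × (0,1))`. -/
def IsItoIntegral (hB : IsBrownianMotion B P) (u : Lp ℝ 2 (P.prod (volume : Measure I)))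
    (X : Lp ℝ 2 P) : Prop :=
  ∃ (un : ℕ → Lp ℝ 2 (P.prod (volume : Measure I))) (Xn : ℕ → Lp ℝ 2 P),
    (∀ n, IsElementaryIto hB (un n) (Xn n)) ∧
    Tendsto un atTop (𝓝 u) ∧ Tendsto Xn atTop (𝓝 X)

end Ito

end Skorokhod

end

noncomputable section

namespace Skorokhod

/-! ### The Wiener integral is an isonormal Gaussian process -/

/-! Everything rests on one Gaussian integration by parts, tested against exponentials: for
polynomial F, E[⟨DF,k⟩ exp(iW(g))] = E[F (W(k) - i⟨g,k⟩) exp(iW(g))]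
(`IsIsonormal.expIntegral_polyDeriv`). Since these exponentials are total, DF depends only on F, and
polynomial variables are dense, so the adjoint is meaningful.

If g is a combination of indicators of [0,r] with r ≤ s, and k is the indicator of [s,t), then ⟨g,k⟩
= 0 and the correction term disappears. Such exponentials already determine integrals over events of
𝓕_s (`setIntegral_eq_zero_of_expIntegral_eq_zero`), so E[Y⟨DF,k⟩] = E[Y F (B_t - B_s)] for every
square-integrable 𝓕_s-measurable Y (`integral_mul_inner_indicatorInterval`). No Malliavin
differentiability of Y is needed. By linearity and L² limits, every Itô integral X of u satisfies
E[XF] = E⟨u,DF⟩ for polynomial F. This equation is closed in the pair (F,DF), so it extends to the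
closure of D: u lies in the domain of δ and X = δ(u). Uniqueness of the Itô integral comes for free.

It remains to see that every adapted u has an Itô integral. With F = W(k) the same identity yields
the Itô isometry on the span of the processes 1_A 1_{[s,t)}, A ∈ 𝓕_s (`IsSimpleIto.inner_eq`), so it
suffices that these are dense in L²_a. Let w be adapted and orthogonal to all of them. Then E[Y
∫_s^t w] = 0 for 𝓕_s-measurable Y, and expanding the square of ∫_0^t w over the triangle r < q gives
E[(∫_0^t w)²] = 2 ∫_0^t E[w_r ∫_r^t w] dr = 0 (`inner_indicatorTime_ae_eq_zero`). Hence w = 0. -/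

instance secondCountableTopology_L2Time : SecondCountableTopology L2Time :=
  have : Fact ((2 : ℝ≥0∞) ≠ ∞) := ⟨ENNReal.ofNat_ne_top⟩
  inferInstance

theorem withDensity_ofReal_apply_eq_iff {α : Type*} [MeasurableSpace α] {μ : Measure α}
    {f : α → ℝ} (hf : Integrable f μ) {A : Set α} (hA : MeasurableSet A) :
    μ.withDensity (fun x ↦ ENNReal.ofReal (f x)) A =
      μ.withDensity (fun x ↦ ENNReal.ofReal (-f x)) A ↔ ∫ x in A, f x ∂μ = 0 := by
  have h1 := hf.integrableOn (s := A)
  rw [withDensity_apply _ hA, withDensity_apply _ hA,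
    integral_eq_lintegral_pos_part_sub_lintegral_neg_part h1, sub_eq_zero,
    ENNReal.toReal_eq_toReal_iff']
  · exact h1.lintegral_lt_top.ne
  · exact h1.neg.lintegral_lt_top.ne

theorem isFiniteMeasure_withDensity_neg {α : Type*} [MeasurableSpace α] {μ : Measure α}
    {f : α → ℝ} (hf : Integrable f μ) :
    IsFiniteMeasure (μ.withDensity fun x ↦ ENNReal.ofReal (-f x)) :=
  isFiniteMeasure_withDensity_ofReal hf.neg.2

/-- The finite measures with densities f⁺ and f⁻ agree on the half-lines `Set.Iic t`, which
determine a finite measure. -/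
theorem eq_zero_of_forall_setIntegral_Iic {f : L2Time}
    (h : ∀ t : I, ∫ x in Set.Iic t, f x = 0) : f = 0 := by
  have hf : Integrable f (volume : Measure I) := (Lp.memLp f).integrable (by norm_num)
  have := isFiniteMeasure_withDensity_ofReal hf.2
  have := isFiniteMeasure_withDensity_neg hf
  have key := Measure.ext_of_Iic _ _ fun t : I ↦
    (withDensity_ofReal_apply_eq_iff hf measurableSet_Iic).2 (h t)
  rw [Lp.eq_zero_iff_ae_eq_zero]
  refine hf.ae_eq_zero_of_forall_setIntegral_eq_zero fun A hA _ ↦ ?_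
  rw [← withDensity_ofReal_apply_eq_iff hf hA, key]

theorem topologicalClosure_span_indicatorTime :
    (Submodule.span ℝ (Set.range indicatorTime)).topologicalClosure = ⊤ := by
  rw [Submodule.topologicalClosure_eq_top_iff, Submodule.eq_bot_iff]
  intro f hf
  refine eq_zero_of_forall_setIntegral_Iic fun t ↦ ?_
  have := hf (indicatorTime t) (Submodule.subset_span ⟨t, rfl⟩)
  rwa [indicatorTime, L2.inner_indicatorConstLp_one] at this

theorem denseRange_linearCombination_indicatorTime :
    DenseRange (Finsupp.linearCombination ℝ indicatorTime) := by
  have h := topologicalClosure_span_indicatorTime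
  rw [← Finsupp.range_linearCombination] at h
  exact (Submodule.dense_iff_topologicalClosure_eq_top).2 h

theorem inner_indicatorTime (s t : I) :
    inner ℝ (indicatorTime s) (indicatorTime t) = min (s : ℝ) (t : ℝ) := by
  rw [indicatorTime, L2.inner_indicatorConstLp_one, indicatorTime,
    integral_congr_ae (ae_restrict_of_ae indicatorConstLp_coeFn),
    integral_indicator_const (1 : ℝ) measurableSet_Iic,
    measureReal_restrict_apply measurableSet_Iic, Set.Iic_inter_Iic]
  rw [measureReal_def, unitInterval.volume_Iic, smul_eq_mul, mul_one, min_comm,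
    ENNReal.toReal_ofReal (min s t).2.1]
  rfl

/-- Norms of linear combinations depend only on the Gram matrix. Applied to Brownian values and time
indicators, this is the isometry behind W. -/
theorem norm_linearCombination_eq {ι E F : Type*} [NormedAddCommGroup E] [InnerProductSpace ℝ E]
    [NormedAddCommGroup F] [InnerProductSpace ℝ F] {e : ι → E} {f : ι → F}
    (h : ∀ i j, inner ℝ (e i) (e j) = inner ℝ (f i) (f j)) (a : ι →₀ ℝ) :
    ‖Finsupp.linearCombination ℝ e a‖ = ‖Finsupp.linearCombination ℝ f a‖ := by
  rw [← sq_eq_sq₀ (norm_nonneg _) (norm_nonneg _), ← real_inner_self_eq_norm_sq,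
    ← real_inner_self_eq_norm_sq]
  simp only [Finsupp.linearCombination_apply, Finsupp.sum, sum_inner, inner_sum,
    real_inner_smul_left, real_inner_smul_right, h]

variable {Ω : Type*} [MeasurableSpace Ω] {P : Measure Ω}

theorem IsBrownianMotion.isProbabilityMeasure {B : I → Ω → ℝ} (hB : IsBrownianMotion B P) :
    IsProbabilityMeasure P :=
  (hB.hasLaw_sub 0 0 le_rfl).hasGaussianLaw.isProbabilityMeasure

theorem IsBrownianMotion.hasGaussianLaw_eval {B : I → Ω → ℝ} (hB : IsBrownianMotion B P) (t : I) :
    HasGaussianLaw (B t) P := by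
  refine (hB.hasLaw_sub 0 t t.2.1).hasGaussianLaw.congr ?_
  filter_upwards [hB.eval_zero] with ω hω
  simp [hω]

theorem IsBrownianMotion.isGaussianProcess {B : I → Ω → ℝ} (hB : IsBrownianMotion B P) :
    IsGaussianProcess B P :=
  hB.hasIndepIncrements.isGaussianProcess hB.hasGaussianLaw_eval hB.eval_zero

theorem IsBrownianMotion.integral_eval {B : I → Ω → ℝ} (hB : IsBrownianMotion B P) (t : I) :
    ∫ ω, B t ω ∂P = 0 := by
  have h := (hB.hasLaw_sub 0 t t.2.1).integral_eq
  rw [integral_id_gaussianReal] at h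
  rw [← h]
  refine integral_congr_ae ?_
  filter_upwards [hB.eval_zero] with ω hω
  simp [hω]

theorem IsBrownianMotion.integral_sub_sq {B : I → Ω → ℝ} (hB : IsBrownianMotion B P) {s t : I}
    (hst : s ≤ t) : ∫ ω, (B t ω - B s ω) ^ 2 ∂P = (t : ℝ) - s := by
  have := hB.isProbabilityMeasure
  have hL := hB.hasLaw_sub s t hst
  have h := hL.variance_eq
  rw [variance_id_gaussianReal, variance_of_integral_eq_zero hL.aemeasurable] at h
  · rw [h, Real.coe_toNNReal _ (sub_nonneg.2 hst)]
  · rw [hL.integral_eq, integral_id_gaussianReal]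

theorem IsBrownianMotion.integral_mul {B : I → Ω → ℝ} (hB : IsBrownianMotion B P) (s t : I) :
    ∫ ω, B s ω * B t ω ∂P = min (s : ℝ) (t : ℝ) := by
  wlog hst : s ≤ t generalizing s t
  · rw [min_comm, ← this t s (le_of_not_ge hst)]
    simp only [mul_comm]
  have hsq : ∀ t : I, ∫ ω, B t ω ^ 2 ∂P = t := fun t ↦ by
    have := hB.integral_sub_sq (s := 0) (t := t) t.2.1
    rw [Set.Icc.coe_zero, sub_zero] at this
    rw [← this]
    refine integral_congr_ae ?_
    filter_upwards [hB.eval_zero] with ω hω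
    simp [hω]
  have h1 := hB.integral_sub_sq hst
  have e : ∀ ω, B s ω * B t ω = (B t ω ^ 2 + B s ω ^ 2 - (B t ω - B s ω) ^ 2) / 2 :=
    fun ω ↦ by ring
  have i1 := (hB.memLp t).integrable_sq
  have i2 := (hB.memLp s).integrable_sq
  have i3 := ((hB.memLp t).sub (hB.memLp s)).integrable_sq
  simp only [Pi.sub_apply] at i3
  simp only [e]
  have i12 : Integrable (fun ω ↦ B t ω ^ 2 + B s ω ^ 2) P := i1.add i2
  rw [integral_div, integral_sub i12 i3, integral_add i1 i2, hsq, hsq, h1,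
    min_eq_left (by exact_mod_cast hst)]
  ring

theorem IsBrownianMotion.inner_toLp {B : I → Ω → ℝ} (hB : IsBrownianMotion B P) (s t : I) :
    inner ℝ (hB.memLp s).toLp (hB.memLp t).toLp =
      inner ℝ (indicatorTime s) (indicatorTime t) := by
  rw [inner_indicatorTime, ← hB.integral_mul s t, L2.inner_def]
  refine integral_congr_ae ?_
  filter_upwards [(hB.memLp s).coeFn_toLp, (hB.memLp t).coeFn_toLp] with ω h1 h2
  simp [h1, h2, mul_comm]

theorem wienerIntegral_linearCombination {B : I → Ω → ℝ} (hB : IsBrownianMotion B P)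
    (a : I →₀ ℝ) : wienerIntegral hB (Finsupp.linearCombination ℝ indicatorTime a) =
      Finsupp.linearCombination ℝ (fun t : I ↦ (hB.memLp t).toLp) a :=
  LinearMap.extendOfNorm_eq denseRange_linearCombination_indicatorTime
    ⟨1, fun x ↦ by rw [one_mul, norm_linearCombination_eq hB.inner_toLp]⟩ a

theorem wienerIntegral_indicatorTime {B : I → Ω → ℝ} (hB : IsBrownianMotion B P) (t : I) :
    wienerIntegral hB (indicatorTime t) = (hB.memLp t).toLp := by
  simpa using wienerIntegral_linearCombination hB (Finsupp.single t 1)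

/-- `W` is an isonormal Gaussian process: `W h` is centered Gaussian with variance `‖h‖²`. -/
def IsIsonormal {H : Type*} [NormedAddCommGroup H] [InnerProductSpace ℝ H]
    (W : H →L[ℝ] Lp ℝ 2 P) : Prop :=
  ∀ h, HasLaw (W h) (gaussianReal 0 (‖h‖₊ ^ 2)) P

theorem hasLaw_gaussianReal_of_hasGaussianLaw [IsProbabilityMeasure P] {X : Ω → ℝ}
    (hX : HasGaussianLaw X P) (h0 : ∫ ω, X ω ∂P = 0) {v : NNReal} (hv : ∫ ω, X ω ^ 2 ∂P = v) :
    HasLaw X (gaussianReal 0 v) P :=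
  ⟨hX.aemeasurable, by
    rw [hX.map_eq_gaussianReal, variance_of_integral_eq_zero hX.aemeasurable h0, h0, hv,
      Real.toNNReal_coe]⟩

theorem Lp_two_norm_sq (X : Lp ℝ 2 P) : ‖X‖ ^ 2 = ∫ ω, X ω ^ 2 ∂P := by
  rw [← real_inner_self_eq_norm_sq, L2.inner_def]
  simp [pow_two]

theorem hasLaw_linearCombination {B : I → Ω → ℝ} (hB : IsBrownianMotion B P) (a : I →₀ ℝ) :
    HasLaw (Finsupp.linearCombination ℝ (fun t : I ↦ (hB.memLp t).toLp) a : Lp ℝ 2 P)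
      (gaussianReal 0 (‖Finsupp.linearCombination ℝ indicatorTime a‖₊ ^ 2)) P := by
  have := hB.isProbabilityMeasure
  have hae : (fun ω ↦ ∑ t ∈ a.support, a t • B t ω) =ᵐ[P]
      (Finsupp.linearCombination ℝ (fun t : I ↦ (hB.memLp t).toLp) a : Lp ℝ 2 P) := by
    rw [Finsupp.linearCombination_apply, Finsupp.sum]
    refine EventuallyEq.trans ?_ (Lp.coeFn_finsetSum _ _).symm
    have : ∀ᵐ ω ∂P, ∀ t ∈ a.support, (a t • (hB.memLp t).toLp : Lp ℝ 2 P) ω = a t • B t ω := by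
      refine (ae_ball_iff a.support.countable_toSet).2 fun t _ ↦ ?_
      filter_upwards [Lp.coeFn_smul (a t) (hB.memLp t).toLp, (hB.memLp t).coeFn_toLp] with ω h1 h2
      rw [h1, Pi.smul_apply, h2]
    filter_upwards [this] with ω hω
    rw [Finset.sum_apply]
    exact (Finset.sum_congr rfl hω).symm
  refine hasLaw_gaussianReal_of_hasGaussianLaw
    ((hB.isGaussianProcess.smul a).hasGaussianLaw_fun_sum.congr hae) ?_ ?_
  · rw [← integral_congr_ae hae, integral_finsetSum]
    · simp [integral_const_mul, hB.integral_eval]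
    · exact fun t _ ↦ ((hB.memLp t).integrable (by norm_num)).smul (a t)
  · rw [← Lp_two_norm_sq, norm_linearCombination_eq hB.inner_toLp]
    simp

/-! ### Characteristic functions and the passage of Gaussian laws to L² limits. -/

theorem norm_exp_I_mul_ofReal_sub_le (a b : ℝ) :
    ‖Complex.exp (Complex.I * a) - Complex.exp (Complex.I * b)‖ ≤ |a - b| := by
  have h : Complex.exp (Complex.I * a) - Complex.exp (Complex.I * b) =
      Complex.exp (Complex.I * b) * (Complex.exp (Complex.I * (a - b : ℝ)) - 1) := by
    rw [mul_sub, ← Complex.exp_add, mul_one]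
    congr 2
    push_cast
    ring
  rw [h, norm_mul, Complex.norm_exp_I_mul_ofReal, one_mul]
  exact Real.norm_exp_I_mul_ofReal_sub_one_le

theorem integrable_exp_I_mul [IsFiniteMeasure P] {X : Ω → ℝ} (hX : AEMeasurable X P) :
    Integrable (fun ω ↦ Complex.exp (Complex.I * X ω)) P := by
  refine Integrable.of_bound (C := 1) (by fun_prop) (ae_of_all _ fun ω ↦ ?_)
  rw [Complex.norm_exp_I_mul_ofReal]

/-- The map x ↦ exp(ix) is 1-Lipschitz and the L¹ norm is at most the L² norm. This makes the
Gaussian characteristic function a closed condition on h. -/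
theorem continuous_integral_exp_I_mul [IsProbabilityMeasure P] :
    Continuous fun X : Lp ℝ 2 P ↦ ∫ ω, Complex.exp (Complex.I * X ω) ∂P := by
  refine LipschitzWith.continuous (K := 1) (LipschitzWith.of_dist_le_mul fun X Y ↦ ?_)
  have hm : ∀ X : Lp ℝ 2 P, AEMeasurable X P := fun X ↦ (Lp.aestronglyMeasurable X).aemeasurable
  rw [dist_eq_norm, ← integral_sub (integrable_exp_I_mul (hm X)) (integrable_exp_I_mul (hm Y)),
    NNReal.coe_one, one_mul, dist_eq_norm]
  have hXY : MemLp (fun ω ↦ X ω - Y ω) 2 P := (Lp.memLp X).sub (Lp.memLp Y)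
  calc _ ≤ ∫ ω, |X ω - Y ω| ∂P := norm_integral_le_of_norm_le
        (hXY.integrable (by norm_num)).abs
        (ae_of_all _ fun ω ↦ norm_exp_I_mul_ofReal_sub_le _ _)
    _ ≤ ‖X - Y‖ := by
      have h1 : ∫ ω, |X ω - Y ω| ∂P = (eLpNorm (fun ω ↦ X ω - Y ω) 1 P).toReal := by
        simp only [← Real.norm_eq_abs]
        rw [integral_norm_eq_lintegral_enorm hXY.1, eLpNorm_one_eq_lintegral_enorm]
      rw [h1, Lp.norm_def, eLpNorm_congr_ae (Lp.coeFn_sub X Y)]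
      exact ENNReal.toReal_mono hXY.2.ne
        (eLpNorm_le_eLpNorm_of_exponent_le (by norm_num) hXY.1)

theorem charFun_map_eq_integral {X : Ω → ℝ} (hX : AEMeasurable X P) (t : ℝ) :
    charFun (P.map X) t = ∫ ω, Complex.exp (Complex.I * (t * X ω : ℝ)) ∂P := by
  rw [charFun_apply_real, integral_map hX (by fun_prop)]
  congr with ω
  push_cast
  ring_nf

theorem integral_exp_I_mul_of_hasLaw {X : Ω → ℝ} {v : NNReal} (hX : HasLaw X (gaussianReal 0 v) P) :
    ∫ ω, Complex.exp (Complex.I * X ω) ∂P = Complex.exp (-((v : ℝ) / 2 : ℝ)) := by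
  have h := charFun_map_eq_integral hX.aemeasurable 1
  rw [hX.map_eq, charFun_gaussianReal] at h
  simp only [one_mul] at h
  rw [← h]
  congr 1
  push_cast
  ring

/-- One value per vector suffices: at t • h it gives the characteristic function of W h at t. -/
theorem isIsonormal_of_integral_exp [IsProbabilityMeasure P] {H : Type*} [NormedAddCommGroup H]
    [InnerProductSpace ℝ H] {W : H →L[ℝ] Lp ℝ 2 P}
    (hW : ∀ h, ∫ ω, Complex.exp (Complex.I * W h ω) ∂P = Complex.exp (-(‖h‖ ^ 2 / 2 : ℝ))) :
    IsIsonormal W := by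
  intro h
  have hm : AEMeasurable (W h) P := (Lp.aestronglyMeasurable _).aemeasurable
  refine ⟨hm, ?_⟩
  have := Measure.isProbabilityMeasure_map hm
  refine Measure.ext_of_charFun (funext fun t ↦ ?_)
  rw [charFun_map_eq_integral hm, charFun_gaussianReal]
  have h1 := hW (t • h)
  rw [map_smul, norm_smul, mul_pow, Real.norm_eq_abs, sq_abs] at h1
  refine Eq.trans (integral_congr_ae ?_) (h1.trans ?_)
  · filter_upwards [Lp.coeFn_smul t (W h)] with ω hω
    rw [hω, Pi.smul_apply, smul_eq_mul]
  · congr 1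
    push_cast
    ring

theorem isIsonormal_wienerIntegral {B : I → Ω → ℝ} (hB : IsBrownianMotion B P) :
    IsIsonormal (wienerIntegral hB) := by
  have := hB.isProbabilityMeasure
  refine isIsonormal_of_integral_exp fun h ↦ ?_
  refine DenseRange.induction_on denseRange_linearCombination_indicatorTime h ?_ fun a ↦ ?_
  · exact isClosed_eq (continuous_integral_exp_I_mul.comp (wienerIntegral hB).continuous)
      (by fun_prop)
  · rw [wienerIntegral_linearCombination, integral_exp_I_mul_of_hasLaw (hasLaw_linearCombination hB a)]
    simp

/-! ### Gaussian integration by parts -/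

section IntegrationByParts

variable {Ω : Type*} [MeasurableSpace Ω] {P : Measure Ω}

/-- Random variables with moments of all orders. -/
def HasAllMoments (X : Ω → ℝ) (P : Measure Ω) : Prop :=
  ∀ p : ℝ≥0∞, p ≠ ∞ → MemLp X p P

theorem HasAllMoments.add {X Y : Ω → ℝ} (hX : HasAllMoments X P) (hY : HasAllMoments Y P) :
    HasAllMoments (fun ω ↦ X ω + Y ω) P :=
  fun p hp ↦ (hX p hp).add (hY p hp)

theorem HasAllMoments.mul {X Y : Ω → ℝ} (hX : HasAllMoments X P) (hY : HasAllMoments Y P) :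
    HasAllMoments (fun ω ↦ X ω * Y ω) P := by
  intro p hp
  -- Hölder's inequality: the product is in L^p because both factors are in L^{2p}.
  have : ENNReal.HolderTriple (2 * p) (2 * p) p := ⟨by
    rw [ENNReal.mul_inv (Or.inl two_ne_zero) (Or.inl ENNReal.ofNat_ne_top), ← two_mul,
      ← mul_assoc, ENNReal.mul_inv_cancel two_ne_zero ENNReal.ofNat_ne_top, one_mul]⟩
  have h2 : 2 * p ≠ ∞ := ENNReal.mul_ne_top ENNReal.ofNat_ne_top hp
  exact (hY _ h2).mul' (hX _ h2)

theorem hasAllMoments_const [IsProbabilityMeasure P] (c : ℝ) : HasAllMoments (fun _ : Ω ↦ c) P :=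
  fun _ _ ↦ memLp_const c

theorem HasAllMoments.sum {ι : Type*} (s : Finset ι) {X : ι → Ω → ℝ}
    (hX : ∀ i, HasAllMoments (X i) P) : HasAllMoments (fun ω ↦ ∑ i ∈ s, X i ω) P :=
  fun p hp ↦ memLp_finsetSum s fun i _ ↦ hX i p hp

theorem HasAllMoments.integrable {X : Ω → ℝ} (hX : HasAllMoments X P) : Integrable X P :=
  memLp_one_iff_integrable.1 (hX 1 ENNReal.one_ne_top)

variable {H : Type*} [NormedAddCommGroup H] [InnerProductSpace ℝ H] {W : H →L[ℝ] Lp ℝ 2 P}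

theorem IsIsonormal.hasAllMoments (hW : IsIsonormal W) (h : H) : HasAllMoments (W h) P :=
  fun _ hp ↦ (hW h).hasGaussianLaw.memLp hp

/-- The polynomial random variable `p(W(h₁), …, W(hₘ))`. -/
def polyEval (W : H →L[ℝ] Lp ℝ 2 P) {m : ℕ} (h : Fin m → H) (p : MvPolynomial (Fin m) ℝ) :
    Ω → ℝ :=
  fun ω ↦ MvPolynomial.eval (fun i ↦ W (h i) ω) p

theorem IsIsonormal.hasAllMoments_eval [IsProbabilityMeasure P] (hW : IsIsonormal W) {m : ℕ} (h : Fin m → H)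
    (p : MvPolynomial (Fin m) ℝ) :
    HasAllMoments (polyEval W h p) P := by
  unfold polyEval
  induction p using MvPolynomial.induction_on with
  | C a => simpa using hasAllMoments_const (P := P) a
  | add p q hp hq => simpa using hp.add hq
  | mul_X p i hp => simpa using hp.mul (hW.hasAllMoments (h i))

/-- The integral `E[F exp(i W(g))]`. -/
def expIntegral (W : H →L[ℝ] Lp ℝ 2 P) (F : Ω → ℝ) (g : H) : ℂ :=
  ∫ ω, (F ω : ℂ) * Complex.exp (Complex.I * W g ω) ∂P

theorem aemeasurable_wiener (W : H →L[ℝ] Lp ℝ 2 P) (h : H) : AEMeasurable (W h) P :=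
  (Lp.aestronglyMeasurable _).aemeasurable

theorem integrable_mul_exp {X F : Ω → ℝ} (hX : AEMeasurable X P) (hF : Integrable F P) :
    Integrable (fun ω ↦ (F ω : ℂ) * Complex.exp (Complex.I * X ω)) P := by
  refine (hF.ofReal (𝕜 := ℂ)).mul_bdd (c := 1) (by fun_prop) (ae_of_all _ fun ω ↦ ?_)
  rw [Complex.norm_exp_I_mul_ofReal]

theorem expIntegral_congr {F G : Ω → ℝ} (h : F =ᵐ[P] G) (g : H) :
    expIntegral W F g = expIntegral W G g := by
  refine integral_congr_ae ?_
  filter_upwards [h] with ω hω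
  rw [hω]

theorem expIntegral_add {F G : Ω → ℝ} (hF : Integrable F P) (hG : Integrable G P) (g : H) :
    expIntegral W (fun ω ↦ F ω + G ω) g = expIntegral W F g + expIntegral W G g := by
  simp only [expIntegral]
  rw [← integral_add (integrable_mul_exp (aemeasurable_wiener W g) hF)
    (integrable_mul_exp (aemeasurable_wiener W g) hG)]
  simp only [Complex.ofReal_add, add_mul]

theorem expIntegral_const_mul (c : ℝ) (F : Ω → ℝ) (g : H) :
    expIntegral W (fun ω ↦ c * F ω) g = c * expIntegral W F g := by
  simp only [expIntegral]
  rw [← integral_const_mul]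
  simp only [Complex.ofReal_mul, mul_assoc]

/-- Differentiation under the integral sign; the ε-derivative of the integrand has modulus |F Y| for
every ε. -/
theorem hasDerivAt_integral_mul_exp {F X Y : Ω → ℝ} (hX : AEMeasurable X P)
    (hY : AEMeasurable Y P) (hF : Integrable F P) (hFY : Integrable (fun ω ↦ F ω * Y ω) P) :
    HasDerivAt (fun ε : ℝ ↦ ∫ ω, (F ω : ℂ) * Complex.exp (Complex.I * (X ω + ε * Y ω : ℝ)) ∂P)
      (Complex.I * ∫ ω, ((F ω * Y ω : ℝ) : ℂ) * Complex.exp (Complex.I * X ω) ∂P) 0 := by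
  have hm : AEMeasurable F P := hF.aemeasurable
  have key := (hasDerivAt_integral_of_dominated_loc_of_deriv_le (μ := P) (x₀ := (0 : ℝ))
    (F := fun (ε : ℝ) ω ↦ (F ω : ℂ) * Complex.exp (Complex.I * (X ω + ε * Y ω : ℝ)))
    (F' := fun (ε : ℝ) ω ↦ Complex.I * (((F ω * Y ω : ℝ) : ℂ) *
      Complex.exp (Complex.I * (X ω + ε * Y ω : ℝ))))
    (bound := fun ω ↦ |F ω * Y ω|) Filter.univ_mem ?_ ?_ ?_ ?_ hFY.abs ?_).2
  · simpa [integral_const_mul] using key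
  · refine Eventually.of_forall fun ε ↦ (integrable_mul_exp ?_ hF).1
    fun_prop
  · refine integrable_mul_exp ?_ hF
    fun_prop
  · refine ((integrable_mul_exp ?_ hFY).const_mul Complex.I).1
    fun_prop
  · refine ae_of_all _ fun ω ε _ ↦ ?_
    rw [norm_mul, norm_mul, Complex.norm_exp_I_mul_ofReal, Complex.norm_I, Complex.norm_real,
      Real.norm_eq_abs, one_mul, mul_one]
  · refine ae_of_all _ fun ω ε _ ↦ ?_
    have h1 : HasDerivAt (fun ε : ℝ ↦ ((X ω + ε * Y ω : ℝ) : ℂ)) (Y ω : ℂ) ε := by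
      have := ((hasDerivAt_id ε).mul_const (Y ω)).const_add (X ω)
      simpa using this.ofReal_comp
    refine (((h1.const_mul Complex.I).cexp).const_mul (F ω : ℂ)).congr_deriv ?_
    rw [Complex.ofReal_mul]
    ring

theorem hasDerivAt_expIntegral {F : Ω → ℝ} {g f : H} (hF : Integrable F P)
    (hFf : Integrable (fun ω ↦ F ω * W f ω) P) :
    HasDerivAt (fun ε : ℝ ↦ expIntegral W F (g + ε • f))
      (Complex.I * expIntegral W (fun ω ↦ F ω * W f ω) g) 0 := by
  have h := hasDerivAt_integral_mul_exp (aemeasurable_wiener W g) (aemeasurable_wiener W f) hF hFf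
  refine h.congr_of_eventuallyEq (Eventually.of_forall fun ε ↦ ?_)
  refine integral_congr_ae ?_
  filter_upwards [Lp.coeFn_add (W g) (ε • W f), Lp.coeFn_smul ε (W f)] with ω h1 h2
  rw [map_add, map_smul, h1, Pi.add_apply, h2, Pi.smul_apply, smul_eq_mul]

theorem IsIsonormal.expIntegral_one [IsProbabilityMeasure P] (hW : IsIsonormal W) (g : H) :
    expIntegral W (fun _ ↦ 1) g = Complex.exp (-(‖g‖ ^ 2 / 2 : ℝ)) := by
  simp only [expIntegral, Complex.ofReal_one, one_mul]
  rw [integral_exp_I_mul_of_hasLaw (hW g)]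
  simp

theorem hasDerivAt_inner_add_smul (g f k : H) :
    HasDerivAt (fun ε : ℝ ↦ ((inner ℝ (g + ε • f) k : ℝ) : ℂ)) ((inner ℝ f k : ℝ) : ℂ) 0 := by
  have h : HasDerivAt (fun ε : ℝ ↦ inner ℝ g k + ε * inner ℝ f k) (inner ℝ f k) 0 := by
    simpa using ((hasDerivAt_id (0 : ℝ)).mul_const (inner ℝ f k)).const_add (inner ℝ g k)
  simpa only [inner_add_left, real_inner_smul_left] using h.ofReal_comp

/-- Differentiate E[exp(iW(g + εk))] = exp(-‖g + εk‖²/2) at ε = 0. This is the base case of the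
integration by parts. -/
theorem IsIsonormal.expIntegral_wiener [IsProbabilityMeasure P] (hW : IsIsonormal W) (g k : H) :
    expIntegral W (W k) g = Complex.I * (inner ℝ g k : ℝ) * expIntegral W (fun _ ↦ 1) g := by
  have h1 := hasDerivAt_expIntegral (W := W) (F := fun _ ↦ 1) (g := g) (f := k)
    (integrable_const _) (by simpa using (hW.hasAllMoments k).integrable)
  simp only [one_mul, hW.expIntegral_one] at h1 ⊢
  have h2 : HasDerivAt (fun ε : ℝ ↦ -(‖g + ε • k‖ ^ 2 / 2 : ℝ)) (-(inner ℝ g k)) 0 := by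
    have h : HasDerivAt (fun ε : ℝ ↦ g + ε • k) k 0 := by
      simpa using ((hasDerivAt_id (0 : ℝ)).smul_const k).const_add g
    refine (h.norm_sq.div_const 2).fun_neg.congr_deriv ?_
    simp
  have h2' := h2.ofReal_comp.cexp
  simp only [Complex.ofReal_neg] at h2'
  have h3 := h1.unique h2'
  simp only [zero_smul, add_zero] at h3
  have h4 : Complex.I * (Complex.I * expIntegral W (W k) g) = - expIntegral W (W k) g := by
    rw [← mul_assoc, Complex.I_mul_I]
    ring
  rw [← neg_inj, ← h4, h3]
  push_cast
  ring

/-- The derivative of `p(W(h₁), …, W(hₘ))` in the direction `k`. -/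
def polyDeriv (W : H →L[ℝ] Lp ℝ 2 P) {m : ℕ} (h : Fin m → H) (p : MvPolynomial (Fin m) ℝ)
    (k : H) : Ω → ℝ :=
  fun ω ↦ ∑ i, MvPolynomial.eval (fun j ↦ W (h j) ω) (MvPolynomial.pderiv i p) * inner ℝ (h i) k

theorem IsIsonormal.hasAllMoments_polyDeriv [IsProbabilityMeasure P] (hW : IsIsonormal W) {m : ℕ} (h : Fin m → H)
    (p : MvPolynomial (Fin m) ℝ) (k : H) : HasAllMoments (polyDeriv W h p k) P :=
  HasAllMoments.sum _ fun _ ↦ (hW.hasAllMoments_eval h _).mul (hasAllMoments_const _)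

theorem polyDeriv_mul_X {m : ℕ} (h : Fin m → H) (p : MvPolynomial (Fin m) ℝ) (i : Fin m) (k : H)
    (ω : Ω) : polyDeriv W h (p * MvPolynomial.X i) k ω =
      polyDeriv W h p k ω * W (h i) ω + inner ℝ (h i) k * polyEval W h p ω := by
  classical
  simp only [polyDeriv, polyEval, MvPolynomial.pderiv_mul, MvPolynomial.pderiv_X, map_add, map_mul,
    MvPolynomial.eval_X, add_mul, Finset.sum_add_distrib, Finset.sum_mul]
  congr 1
  · exact Finset.sum_congr rfl fun j _ ↦ by ring
  · rw [Finset.sum_eq_single i]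
    · simp [mul_comm]
    · intro j _ hj
      simp [hj.symm]
    · simp

/-- Integration by parts against exponentials:
`E[⟨DF, k⟩ exp(i W(g))] = E[F (W(k) - i ⟨g, k⟩) exp(i W(g))]` for polynomial `F`. -/
theorem IsIsonormal.expIntegral_polyDeriv [IsProbabilityMeasure P] (hW : IsIsonormal W) {m : ℕ} (h : Fin m → H)
    (p : MvPolynomial (Fin m) ℝ) (g k : H) :
    expIntegral W (polyDeriv W h p k) g = expIntegral W (fun ω ↦ polyEval W h p ω * W k ω) g -
      Complex.I * (inner ℝ g k : ℝ) * expIntegral W (polyEval W h p) g := by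
  have hE := fun p ↦ hW.hasAllMoments_eval h p
  have hD := fun p ↦ hW.hasAllMoments_polyDeriv h p k
  have hM := hW.hasAllMoments
  -- The direction g must vary: multiplication by a variable uses the hypothesis at all g + ε • h i.
  induction p using MvPolynomial.induction_on generalizing g with
  | C a =>
    have h1 : polyDeriv W h (MvPolynomial.C a) k = fun _ ↦ 0 * 1 := by
      ext ω
      simp [polyDeriv]
    have h2 : polyEval W h (MvPolynomial.C a) = fun _ ↦ a * 1 := by
      ext ω
      simp [polyEval]
    have h3 : (fun ω ↦ polyEval W h (MvPolynomial.C a) ω * W k ω) = fun ω ↦ a * W k ω := by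
      simp [polyEval]
    rw [h3, h1, h2, expIntegral_const_mul, expIntegral_const_mul, expIntegral_const_mul, hW.expIntegral_wiener]
    push_cast
    ring
  | add p q hp hq =>
    have h1 : polyDeriv W h (p + q) k = fun ω ↦ polyDeriv W h p k ω + polyDeriv W h q k ω := by
      ext ω
      simp [polyDeriv, add_mul, Finset.sum_add_distrib]
    have h2 : polyEval W h (p + q) = fun ω ↦ polyEval W h p ω + polyEval W h q ω := by
      ext ω
      simp [polyEval]
    rw [h1, h2, expIntegral_add (hD p).integrable (hD q).integrable,
      expIntegral_add (hE p).integrable (hE q).integrable, hp, hq]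
    simp only [add_mul]
    rw [expIntegral_add ((hE p).mul (hM k)).integrable ((hE q).mul (hM k)).integrable]
    ring
  | mul_X p i hp =>
    have h1 : polyDeriv W h (p * MvPolynomial.X i) k = fun ω ↦
        polyDeriv W h p k ω * W (h i) ω + inner ℝ (h i) k * polyEval W h p ω :=
      funext (polyDeriv_mul_X h p i k)
    have h2 : polyEval W h (p * MvPolynomial.X i) = fun ω ↦ polyEval W h p ω * W (h i) ω := by
      ext ω
      simp [polyEval]
    have h3 : (fun ω ↦ polyEval W h p ω * W (h i) ω * W k ω) =
        fun ω ↦ polyEval W h p ω * W k ω * W (h i) ω := by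
      ext ω
      ring
    rw [h1, h2, h3, expIntegral_add ((hD p).mul (hM _)).integrable
      ((hasAllMoments_const _).mul (hE p)).integrable, expIntegral_const_mul]
    -- Moving g along h i brings down a factor i W(h i). Differentiating both sides of the identity
    -- for p at ε = 0 therefore gives the one for p times the variable, up to the factor i; the
    -- derivative of ⟨g + ε h i, k⟩ supplies the extra term of the product rule.
    have d1 := hasDerivAt_expIntegral (g := g) (f := h i) (hD p).integrable
      ((hD p).mul (hM _)).integrable
    have d2 := hasDerivAt_expIntegral (g := g) (f := h i) ((hE p).mul (hM k)).integrable
      (((hE p).mul (hM k)).mul (hM _)).integrable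
    have d3 := hasDerivAt_expIntegral (g := g) (f := h i) (hE p).integrable
      ((hE p).mul (hM _)).integrable
    have d4 := d2.sub ((((hasDerivAt_inner_add_smul g (h i) k).const_mul Complex.I)).mul d3)
    have d5 : (fun ε : ℝ ↦ expIntegral W (polyDeriv W h p k) (g + ε • h i)) = _ :=
      funext fun ε ↦ hp (g + ε • h i)
    rw [d5] at d1
    have d6 := d1.unique d4
    simp only [zero_smul, add_zero] at d6
    refine mul_left_cancel₀ Complex.I_ne_zero ?_
    rw [mul_add, d6]
    simp only [polyEval]
    ring

end IntegrationByParts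

/-! ### Exponentials and polynomials are total -/

section Totality

variable {Ω : Type*} [mΩ : MeasurableSpace Ω] {P : Measure Ω}

/-- The hypothesis says that Z has zero conditional expectation given m, and Y can be pulled out of
the conditional expectation of Y Z. -/
theorem integral_mul_eq_zero_of_forall_setIntegral_eq_zero [IsFiniteMeasure P]
    {m : MeasurableSpace Ω} (hm : m ≤ mΩ) {Y Z : Ω → ℝ} (hZ : Integrable Z P)
    (h : ∀ A, MeasurableSet[m] A → ∫ ω in A, Z ω ∂P = 0) (hY : AEStronglyMeasurable[m] Y P)
    (hYZ : Integrable (fun ω ↦ Y ω * Z ω) P) : ∫ ω, Y ω * Z ω ∂P = 0 := by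
  have h1 : (0 : Ω → ℝ) =ᵐ[P] P[Z|m] := by
    refine ae_eq_condExp_of_forall_setIntegral_eq hm hZ (fun _ _ _ ↦ integrableOn_zero)
      (fun A hA _ ↦ ?_) aestronglyMeasurable_zero
    simp [h A hA]
  have h2 : P[fun ω ↦ Y ω * Z ω|m] =ᵐ[P] fun ω ↦ Y ω * P[Z|m] ω :=
    condExp_mul_of_aestronglyMeasurable_left hY hYZ hZ
  rw [← integral_condExp hm, integral_congr_ae h2]
  refine integral_eq_zero_of_ae ?_
  filter_upwards [h1] with ω hω
  simp [← hω]

theorem integral_withDensity_sub_integral_withDensity {X : Ω → ℝ} (hX : Integrable X P)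
    {f : Ω → ℂ} (hf : Measurable f) (hb : ∀ ω, ‖f ω‖ ≤ 1) :
    ∫ ω, f ω ∂(P.withDensity fun ω ↦ ENNReal.ofReal (X ω)) -
      ∫ ω, f ω ∂(P.withDensity fun ω ↦ ENNReal.ofReal (-X ω)) = ∫ ω, (X ω : ℂ) * f ω ∂P := by
  have hi : ∀ {Y : Ω → ℝ}, Integrable Y P → Integrable (fun ω ↦ (max (Y ω) 0) • f ω) P :=
    fun {Y} hY ↦ by
      refine (hY.pos_part.ofReal (𝕜 := ℂ)).mul_bdd (c := 1) hf.aestronglyMeasurable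
        (ae_of_all _ hb) |>.congr (ae_of_all _ fun ω ↦ ?_)
      simp
  rw [integral_withDensity_eq_integral_toReal_smul₀ (by fun_prop) (by simp),
    integral_withDensity_eq_integral_toReal_smul₀ (by fun_prop) (by simp)]
  simp only [ENNReal.toReal_ofReal']
  rw [← integral_sub (hi hX) (hi (Y := fun ω ↦ -X ω) hX.neg)]
  refine integral_congr_ae (ae_of_all _ fun ω ↦ ?_)
  simp only [Complex.real_smul, ← sub_mul, ← Complex.ofReal_sub, max_zero_sub_eq_self]

/-- Completion changes events only by null sets, so each event of 𝓕_s may be replaced by one in the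
σ-algebra of the path up to s. -/
theorem brownianFiltration_le_eventuallyMeasurableSpace {B : I → Ω → ℝ}
    (hB : IsBrownianMotion B P) (s : I) : brownianFiltration hB s ≤ eventuallyMeasurableSpace
      (MeasurableSpace.comap (fun ω (r : Set.Iic s) ↦ B r ω) inferInstance) (ae P) := by
  refine sup_le (iSup₂_le fun r hr ↦ ?_) (MeasurableSpace.generateFrom_le fun N hN ↦ ?_)
  · refine le_trans ?_ le_eventuallyMeasurableSpace
    rintro _ ⟨C, hC, rfl⟩
    exact ⟨(fun x : Set.Iic s → ℝ ↦ x ⟨r, hr⟩) ⁻¹' C, measurable_pi_apply _ hC, rfl⟩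
  · exact ⟨∅, (MeasurableSpace.comap _ inferInstance).measurableSet_empty, ae_eq_empty.2 hN.2⟩

theorem wienerIntegral_sum_indicatorTime {B : I → Ω → ℝ} (hB : IsBrownianMotion B P)
    {ι : Type*} (J : Finset ι) (c : ι → ℝ) (t : ι → I) :
    wienerIntegral hB (∑ j ∈ J, c j • indicatorTime (t j)) =ᵐ[P]
      fun ω ↦ ∑ j ∈ J, c j * B (t j) ω := by
  simp only [map_sum, map_smul, wienerIntegral_indicatorTime]
  refine (Lp.coeFn_finsetSum _ _).trans ?_
  have : ∀ᵐ ω ∂P, ∀ j ∈ J,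
      (c j • (hB.memLp (t j)).toLp : Lp ℝ 2 P) ω = c j * B (t j) ω := by
    refine (ae_ball_iff J.countable_toSet).2 fun j _ ↦ ?_
    filter_upwards [Lp.coeFn_smul (c j) (hB.memLp (t j)).toLp, (hB.memLp (t j)).coeFn_toLp]
      with ω h1 h2
    rw [h1, Pi.smul_apply, h2, smul_eq_mul]
  filter_upwards [this] with ω hω
  rw [Finset.sum_apply]
  exact Finset.sum_congr rfl hω

/-- The exponentials `exp(i W(g))`, with `g` a combination of indicator functions `1_{[0,r]}`,
`r ≤ s`, are total for `𝓕_s`. -/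
theorem setIntegral_eq_zero_of_expIntegral_eq_zero {B : I → Ω → ℝ}
    (hB : IsBrownianMotion B P) (s : I) {X : Ω → ℝ} (hX : Integrable X P)
    (h : ∀ g ∈ Submodule.span ℝ (indicatorTime '' Set.Iic s),
      expIntegral (wienerIntegral hB) X g = 0)
    {A : Set Ω} (hA : MeasurableSet[brownianFiltration hB s] A) : ∫ ω in A, X ω ∂P = 0 := by
  obtain ⟨_, ⟨C, hC, rfl⟩, hAC⟩ := brownianFiltration_le_eventuallyMeasurableSpace hB s A hA
  set ψ : Ω → Set.Iic s → ℝ := fun ω r ↦ B r ω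
  have hψ : Measurable ψ := measurable_pi_lambda _ fun r ↦ hB.measurable r
  have := isFiniteMeasure_withDensity_ofReal hX.2
  have := isFiniteMeasure_withDensity_neg hX
  rw [setIntegral_congr_set hAC, ← withDensity_ofReal_apply_eq_iff hX (hψ hC),
    ← Measure.map_apply hψ hC, ← Measure.map_apply hψ hC]
  refine congrArg (fun ν : Measure (Set.Iic s → ℝ) ↦ ν C) ?_
  -- The measures with densities X⁺ and X⁻ are pushed to path space, where finite-dimensional
  -- marginals determine them. Each marginal is then identified by its characteristic function.
  refine IsProjectiveLimit.unique
    (P := fun J ↦ ((P.withDensity fun ω ↦ ENNReal.ofReal (-X ω)).map ψ).map J.restrict)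
    (fun J ↦ ?_) (fun J ↦ rfl)
  refine Measure.ext_of_charFunDual (funext fun L ↦ ?_)
  have hr : Measurable (J.restrict : (Set.Iic s → ℝ) → _) := by fun_prop
  beta_reduce
  rw [Measure.map_map hr hψ, Measure.map_map hr hψ, charFunDual_apply, charFunDual_apply,
    integral_map (hr.comp hψ).aemeasurable (by fun_prop),
    integral_map (hr.comp hψ).aemeasurable (by fun_prop), ← sub_eq_zero,
    integral_withDensity_sub_integral_withDensity hX]
  · classical
    set c : J → ℝ := fun j ↦ L (Pi.single j 1)
    have hL : ∀ x : J → ℝ, L x = ∑ j, c j * x j := fun x ↦ by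
      conv_lhs => rw [← Finset.univ_sum_single x, map_sum]
      refine Finset.sum_congr rfl fun j _ ↦ ?_
      rw [show (Pi.single j (x j) : J → ℝ) = x j • Pi.single j 1 by
        rw [← Pi.single_smul, smul_eq_mul, mul_one], map_smul, smul_eq_mul, mul_comm]
    -- The functional L of the sampled path is W of this step function, so the difference of the two
    -- characteristic functions is one of the vanishing exponential integrals.
    have hg := h (∑ j, c j • indicatorTime (j : Set.Iic s)) <| Submodule.sum_mem _ fun j _ ↦
      Submodule.smul_mem _ _ (Submodule.subset_span ⟨_, j.1.2, rfl⟩)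
    rw [← hg]
    refine integral_congr_ae ?_
    filter_upwards [wienerIntegral_sum_indicatorTime hB Finset.univ c
      (fun j ↦ ((j : Set.Iic s) : I))] with ω hω
    rw [hω, Function.comp_apply, hL, mul_comm Complex.I]
    rfl
  · have : Measurable L := L.continuous.measurable
    have h2 : Measurable (J.restrict ∘ ψ) := hr.comp hψ
    fun_prop
  · intro ω
    rw [mul_comm, Complex.norm_exp_I_mul_ofReal]

theorem ae_eq_zero_of_expIntegral_eq_zero {B : I → Ω → ℝ} (hB : IsBrownianMotion B P)
    (hF : brownianFiltration hB 1 = mΩ) {X : Ω → ℝ} (hX : Integrable X P)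
    (h : ∀ g, expIntegral (wienerIntegral hB) X g = 0) : X =ᵐ[P] 0 :=
  hX.ae_eq_zero_of_forall_setIntegral_eq_zero fun A hA _ ↦
    setIntegral_eq_zero_of_expIntegral_eq_zero hB 1 hX (fun g _ ↦ h g) (by rwa [hF])

/-! ### Exponential moments: from powers of W(g) to exponentials. -/

theorem integrable_exp_abs_of_hasLaw {X : Ω → ℝ} {v : NNReal} (hX : HasLaw X (gaussianReal 0 v) P)
    (t : ℝ) : Integrable (fun ω ↦ Real.exp (t * |X ω|)) P := by
  have h : ∀ t : ℝ, Integrable (fun ω ↦ Real.exp (t * X ω)) P := fun t ↦ by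
    have := integrable_exp_mul_gaussianReal (μ := 0) (v := v) t
    rw [← hX.map_eq] at this
    exact this.comp_aemeasurable hX.aemeasurable
  exact integrable_exp_mul_abs (h t) (h (-t))

/-- Expand the exponential in powers of W(g) and integrate termwise. The partial sums are dominated
by |X| exp|W(g)|, integrable as a product of two L² functions. -/
theorem IsIsonormal.expIntegral_eq_zero_of_forall_pow {H : Type*} [NormedAddCommGroup H]
    [InnerProductSpace ℝ H] {W : H →L[ℝ] Lp ℝ 2 P} (hW : IsIsonormal W) {X : Ω → ℝ}
    (hX : MemLp X 2 P) {g : H} (h : ∀ n : ℕ, ∫ ω, X ω * W g ω ^ n ∂P = 0) :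
    expIntegral W X g = 0 := by
  have hm := aemeasurable_wiener W g
  have hm' := hX.1
  have hexp : MemLp (fun ω ↦ Real.exp |W g ω|) 2 P := by
    rw [memLp_two_iff_integrable_sq (by fun_prop)]
    refine (integrable_exp_abs_of_hasLaw (hW g) 2).congr (ae_of_all _ fun ω ↦ ?_)
    simp only [← Real.exp_nat_mul]
    norm_num
  have hs : ∀ ω, HasSum (fun n : ℕ ↦ |X ω| * (|W g ω| ^ n / n.factorial))
      (|X ω| * Real.exp |W g ω|) := fun ω ↦ by
    refine HasSum.mul_left _ ?_
    rw [Real.exp_eq_exp_ℝ]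
    exact NormedSpace.expSeries_div_hasSum_exp _
  have key := hasSum_integral_of_dominated_convergence (μ := P)
    (F := fun (n : ℕ) ω ↦ (X ω : ℂ) * ((Complex.I * W g ω) ^ n / n.factorial))
    (f := fun ω ↦ (X ω : ℂ) * Complex.exp (Complex.I * W g ω))
    (fun n ω ↦ |X ω| * (|W g ω| ^ n / n.factorial))
    (fun n ↦ by fun_prop) (fun n ↦ ae_of_all _ fun ω ↦ by simp)
    (ae_of_all _ fun ω ↦ (hs ω).summable) ?_ (ae_of_all _ fun ω ↦ ?_)
  · refine key.unique ?_
    convert hasSum_zero with n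
    have : ∀ ω, (X ω : ℂ) * ((Complex.I * W g ω) ^ n / n.factorial) =
        Complex.I ^ n / n.factorial * ((X ω * W g ω ^ n : ℝ) : ℂ) := fun ω ↦ by
      push_cast
      ring
    simp only [this]
    rw [integral_const_mul, integral_complex_ofReal, h n]
    simp
  · simp only [fun ω ↦ (hs ω).tsum_eq]
    exact hX.abs.integrable_mul hexp
  · refine HasSum.mul_left _ ?_
    rw [Complex.exp_eq_exp_ℂ]
    exact NormedSpace.expSeries_div_hasSum_exp _

end Totality

/-! ### The Malliavin derivative and its adjoint -/

section MalliavinOperator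

variable {Ω : Type*} [mΩ : MeasurableSpace Ω] {P : Measure Ω}
  {H : Type*} [NormedAddCommGroup H] [InnerProductSpace ℝ H] {W : H →L[ℝ] Lp ℝ 2 P}

theorem inner_ae_eq_polyDeriv {m : ℕ} {p : MvPolynomial (Fin m) ℝ} {h : Fin m → H}
    {G : Lp H 2 P} (hG : ∀ᵐ ω ∂P, G ω =
      ∑ i, MvPolynomial.eval (fun j ↦ W (h j) ω) (MvPolynomial.pderiv i p) • h i) (k : H) :
    (fun ω ↦ inner ℝ (G ω) k) =ᵐ[P] polyDeriv W h p k := by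
  filter_upwards [hG] with ω hω
  simp only [hω, sum_inner, real_inner_smul_left, polyDeriv]

theorem memLp_inner_const (G : Lp H 2 P) (k : H) : MemLp (fun ω ↦ inner ℝ (G ω) k) 2 P :=
  (Lp.memLp G).inner_const k

theorem IsPolynomialWithDerivative.expIntegral_inner [IsProbabilityMeasure P] (hW : IsIsonormal W) {F : Lp ℝ 2 P}
    {G : Lp H 2 P} (h : IsPolynomialWithDerivative W F G) (g k : H) :
    expIntegral W (fun ω ↦ inner ℝ (G ω) k) g = expIntegral W (fun ω ↦ F ω * W k ω) g -
      Complex.I * (inner ℝ g k : ℝ) * expIntegral W F g := by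
  obtain ⟨m, p, f, hF, hG⟩ := h
  rw [expIntegral_congr (inner_ae_eq_polyDeriv hG k), hW.expIntegral_polyDeriv,
    expIntegral_congr (F := F) (G := polyEval W f p) hF]
  congr 1
  refine expIntegral_congr ?_ g
  filter_upwards [hF] with ω hω
  rw [hω, polyEval]

theorem IsPolynomialWithDerivative.hasAllMoments [IsProbabilityMeasure P] (hW : IsIsonormal W) {F : Lp ℝ 2 P}
    {G : Lp H 2 P} (h : IsPolynomialWithDerivative W F G) : HasAllMoments F P := by
  obtain ⟨m, p, f, hF, hG⟩ := h
  exact fun q hq ↦ (hW.hasAllMoments_eval f p q hq).ae_eq (EventuallyEq.symm hF)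

theorem expIntegral_inner_of_mem_span [IsProbabilityMeasure P] (hW : IsIsonormal W) {x : Lp ℝ 2 P × Lp H 2 P}
    (hx : x ∈ Submodule.span ℝ
      {x : Lp ℝ 2 P × Lp H 2 P | IsPolynomialWithDerivative W x.1 x.2}) (g k : H) :
    expIntegral W (fun ω ↦ inner ℝ (x.2 ω) k) g = expIntegral W (fun ω ↦ x.1 ω * W k ω) g -
      Complex.I * (inner ℝ g k : ℝ) * expIntegral W x.1 g := by
  have i1 : ∀ x : Lp ℝ 2 P × Lp H 2 P, Integrable (fun ω ↦ inner ℝ (x.2 ω) k) P :=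
    fun x ↦ (memLp_inner_const x.2 k).integrable (by norm_num)
  have i2 : ∀ x : Lp ℝ 2 P × Lp H 2 P, Integrable (fun ω ↦ x.1 ω * W k ω) P :=
    fun x ↦ (Lp.memLp x.1).integrable_mul (Lp.memLp (W k))
  have i3 : ∀ x : Lp ℝ 2 P × Lp H 2 P, Integrable x.1 P :=
    fun x ↦ (Lp.memLp x.1).integrable (by norm_num)
  induction hx using Submodule.span_induction with
  | mem x hx => exact IsPolynomialWithDerivative.expIntegral_inner hW hx g k
  | zero =>
    -- Zero is written as a multiple so that `expIntegral_const_mul` evaluates the integral.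
    have h1 : (fun ω ↦ inner ℝ ((0 : Lp H 2 P) ω) k) =ᵐ[P] fun _ ↦ 0 * 0 :=
      ae_of_all _ fun ω ↦ by simp
    have h2 : (0 : Lp ℝ 2 P) =ᵐ[P] fun _ ↦ 0 * 0 :=
      ae_of_all _ fun ω ↦ by simp
    have h3 : (fun ω ↦ (0 : Lp ℝ 2 P) ω * W k ω) =ᵐ[P] fun _ ↦ 0 * 0 :=
      ae_of_all _ fun ω ↦ by simp
    simp only [Prod.fst_zero, Prod.snd_zero]
    rw [expIntegral_congr h1, expIntegral_congr h2, expIntegral_congr h3, expIntegral_const_mul]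
    simp
  | add x y _ _ hx hy =>
    have h1 : (fun ω ↦ inner ℝ ((x.2 + y.2) ω) k) =ᵐ[P]
        fun ω ↦ inner ℝ (x.2 ω) k + inner ℝ (y.2 ω) k := by
      filter_upwards [Lp.coeFn_add x.2 y.2] with ω hω
      rw [hω, Pi.add_apply, inner_add_left]
    have h2 : (x.1 + y.1 : Lp ℝ 2 P) =ᵐ[P] fun ω ↦ x.1 ω + y.1 ω := Lp.coeFn_add x.1 y.1
    have h3 : (fun ω ↦ (x.1 + y.1) ω * W k ω) =ᵐ[P]
        fun ω ↦ x.1 ω * W k ω + y.1 ω * W k ω := by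
      filter_upwards [h2] with ω hω
      rw [hω, add_mul]
    simp only [Prod.fst_add, Prod.snd_add]
    rw [expIntegral_congr h1, expIntegral_congr h2, expIntegral_congr h3,
      expIntegral_add (i1 x) (i1 y), expIntegral_add (i2 x) (i2 y),
      expIntegral_add (i3 x) (i3 y), hx, hy]
    ring
  | smul c x _ hx =>
    have h1 : (fun ω ↦ inner ℝ ((c • x.2) ω) k) =ᵐ[P] fun ω ↦ c * inner ℝ (x.2 ω) k := by
      filter_upwards [Lp.coeFn_smul c x.2] with ω hω
      simp [hω, real_inner_smul_left]
    have h2 : (c • x.1 : Lp ℝ 2 P) =ᵐ[P] fun ω ↦ c * x.1 ω := Lp.coeFn_smul c x.1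
    have h3 : (fun ω ↦ (c • x.1) ω * W k ω) =ᵐ[P] fun ω ↦ c * (x.1 ω * W k ω) := by
      filter_upwards [h2] with ω hω
      rw [hω, mul_assoc]
    simp only [Prod.smul_fst, Prod.smul_snd]
    rw [expIntegral_congr h1, expIntegral_congr h2, expIntegral_congr h3,
      expIntegral_const_mul, expIntegral_const_mul, expIntegral_const_mul, hx]
    ring

/-- Totality of the exponentials `exp(i W(g))` in `L¹(Ω)`. -/
def IsTotal (W : H →L[ℝ] Lp ℝ 2 P) : Prop :=
  ∀ X : Ω → ℝ, Integrable X P → (∀ g, expIntegral W X g = 0) → X =ᵐ[P] 0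

/-- The span really is a graph: if the first component vanishes, integration by parts makes every
exponential integral of ⟨G,k⟩ vanish, so G = 0 by totality. -/
theorem malliavinPolynomial_graph [IsProbabilityMeasure P] [SecondCountableTopology H] (hW : IsIsonormal W)
    (hT : IsTotal W) : (malliavinPolynomial W).graph = Submodule.span ℝ
      {x : Lp ℝ 2 P × Lp H 2 P | IsPolynomialWithDerivative W x.1 x.2} := by
  refine Submodule.toLinearPMap_graph_eq _ fun x hx hx0 ↦ ?_
  rw [Lp.eq_zero_iff_ae_eq_zero]
  refine ae_eq_zero_of_forall_inner (𝕜 := ℝ) fun k ↦ ?_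
  have h0 : x.1 =ᵐ[P] fun _ ↦ 0 * 0 := by
    rw [hx0]
    exact ae_of_all _ fun ω ↦ by simp
  have h1 : (fun ω ↦ x.1 ω * W k ω) =ᵐ[P] fun _ ↦ 0 * 0 := by
    filter_upwards [h0] with ω hω
    simp [hω]
  have key := hT (fun ω ↦ inner ℝ (x.2 ω) k)
    ((memLp_inner_const x.2 k).integrable (by norm_num)) fun g ↦ by
      rw [expIntegral_inner_of_mem_span hW hx, expIntegral_congr h0, expIntegral_congr h1,
        expIntegral_const_mul]
      simp
  filter_upwards [key] with ω hω
  rw [real_inner_comm, hω]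

theorem exists_isPolynomialWithDerivative [IsProbabilityMeasure P] (hW : IsIsonormal W) {m : ℕ}
    (p : MvPolynomial (Fin m) ℝ) (h : Fin m → H) :
    ∃ (F : Lp ℝ 2 P) (G : Lp H 2 P), IsPolynomialWithDerivative W F G ∧
      F =ᵐ[P] polyEval W h p ∧ ∀ k, (fun ω ↦ inner ℝ (G ω) k) =ᵐ[P] polyDeriv W h p k := by
  have h1 : MemLp (polyEval W h p) 2 P := hW.hasAllMoments_eval h p 2 ENNReal.ofNat_ne_top
  have h2 : MemLp (fun ω ↦ ∑ i, MvPolynomial.eval (fun j ↦ W (h j) ω)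
      (MvPolynomial.pderiv i p) • h i) 2 P := memLp_finsetSum _ fun i _ ↦
    (ContinuousLinearMap.toSpanSingleton ℝ (h i)).comp_memLp'
      (hW.hasAllMoments_eval h (MvPolynomial.pderiv i p) 2 ENNReal.ofNat_ne_top)
  exact ⟨h1.toLp, h2.toLp, ⟨m, p, h, h1.coeFn_toLp, h2.coeFn_toLp⟩, h1.coeFn_toLp,
    inner_ae_eq_polyDeriv h2.coeFn_toLp⟩

/-- A vector orthogonal to all powers of every W(g) has vanishing exponential integrals, hence is
zero. -/
theorem dense_malliavinPolynomial_domain [IsProbabilityMeasure P] (hW : IsIsonormal W) (hT : IsTotal W) :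
    Dense ((malliavinPolynomial W).domain : Set (Lp ℝ 2 P)) := by
  rw [Submodule.dense_iff_topologicalClosure_eq_top, Submodule.topologicalClosure_eq_top_iff,
    Submodule.eq_bot_iff]
  intro X hX
  rw [Lp.eq_zero_iff_ae_eq_zero]
  refine hT X ((Lp.memLp X).integrable (by norm_num)) fun g ↦
    hW.expIntegral_eq_zero_of_forall_pow (Lp.memLp X) fun n ↦ ?_
  obtain ⟨F, G, hFG, hF, -⟩ := exists_isPolynomialWithDerivative hW
    (MvPolynomial.X (0 : Fin 1) ^ n) fun _ ↦ g
  have h0 := hX F ⟨(F, G), Submodule.subset_span hFG, rfl⟩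
  rw [L2.inner_def] at h0
  rw [← h0]
  refine integral_congr_ae ?_
  filter_upwards [hF] with ω hω
  simp [hω, polyEval]

theorem dense_malliavinDerivative_domain [IsProbabilityMeasure P] (hW : IsIsonormal W) (hT : IsTotal W) :
    Dense ((malliavinDerivative W).domain : Set (Lp ℝ 2 P)) :=
  (dense_malliavinPolynomial_domain hW hT).mono (LinearPMap.le_closure _).1

/-- Closability need not be settled here: for a non-closable operator `closure` returns the operator
itself, and the inclusion still holds. -/
theorem malliavinDerivative_graph_le (W : H →L[ℝ] Lp ℝ 2 P) :
    (malliavinDerivative W).graph ≤ (malliavinPolynomial W).graph.topologicalClosure := by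
  by_cases h : (malliavinPolynomial W).IsClosable
  · exact h.graph_closure_eq_closure_graph.ge
  · rw [malliavinDerivative, LinearPMap.closure_def' h]
    exact Submodule.le_topologicalClosure _

theorem inner_eq_of_mem_span {U : Lp H 2 P} {X : Lp ℝ 2 P}
    (h : ∀ F G, IsPolynomialWithDerivative W F G → inner ℝ X F = inner ℝ U G)
    {x : Lp ℝ 2 P × Lp H 2 P} (hx : x ∈ Submodule.span ℝ
      {x : Lp ℝ 2 P × Lp H 2 P | IsPolynomialWithDerivative W x.1 x.2}) :
    inner ℝ X x.1 = inner ℝ U x.2 := by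
  induction hx using Submodule.span_induction with
  | mem y hy => exact h _ _ hy
  | zero => rw [Prod.fst_zero, Prod.snd_zero, inner_zero_right, inner_zero_right]
  | add y z _ _ hy hz =>
    rw [Prod.fst_add, Prod.snd_add, inner_add_right, inner_add_right, hy, hz]
  | smul c y _ hy =>
    rw [Prod.smul_fst, Prod.smul_snd, real_inner_smul_right, real_inner_smul_right, hy]

theorem inner_malliavinDerivative_eq [IsProbabilityMeasure P] [SecondCountableTopology H]
    (hW : IsIsonormal W) (hT : IsTotal W) {U : Lp H 2 P} {X : Lp ℝ 2 P}
    (h : ∀ F G, IsPolynomialWithDerivative W F G → inner ℝ X F = inner ℝ U G)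
    (x : (malliavinDerivative W).domain) :
    inner ℝ X (x : Lp ℝ 2 P) = inner ℝ U (malliavinDerivative W x) := by
  have hx := malliavinDerivative_graph_le W (LinearPMap.mem_graph _ x)
  rw [malliavinPolynomial_graph hW hT] at hx
  have hc : IsClosed {x : Lp ℝ 2 P × Lp H 2 P | inner ℝ X x.1 = inner ℝ U x.2} :=
    isClosed_eq (continuous_const.inner continuous_fst) (continuous_const.inner continuous_snd)
  exact closure_minimal (fun y hy ↦ inner_eq_of_mem_span h hy) hc hx


theorem mem_divergence_domain [IsProbabilityMeasure P] [SecondCountableTopology H]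
    (hW : IsIsonormal W) (hT : IsTotal W) {U : Lp H 2 P} {X : Lp ℝ 2 P}
    (h : ∀ F G, IsPolynomialWithDerivative W F G → inner ℝ X F = inner ℝ U G) :
    U ∈ (divergence W).domain := by
  have hi := inner_malliavinDerivative_eq hW hT h
  rw [divergence]
  exact LinearPMap.mem_adjoint_domain_of_exists U ⟨X, hi⟩

theorem divergence_eq [IsProbabilityMeasure P] [SecondCountableTopology H]
    (hW : IsIsonormal W) (hT : IsTotal W) {U : Lp H 2 P} {X : Lp ℝ 2 P}
    (h : ∀ F G, IsPolynomialWithDerivative W F G → inner ℝ X F = inner ℝ U G)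
    (hU : U ∈ (divergence W).domain) : divergence W ⟨U, hU⟩ = X := by
  have hi := inner_malliavinDerivative_eq hW hT h
  -- Density of the domain is what makes the value of the adjoint uniquely determined by the duality
  -- relation.
  have hd := dense_malliavinDerivative_domain hW hT
  unfold divergence at hU ⊢
  exact LinearPMap.adjoint_apply_eq hd ⟨U, hU⟩ hi

end MalliavinOperator

/-! ### The identification `L²(Ω × (0,1)) → L²(Ω; L²(0,1))` is a linear isometry -/

section IdentificationIsometry

variable {Ω : Type*} [MeasurableSpace Ω] {P : Measure Ω} [IsProbabilityMeasure P]

theorem toHilbertValued_add (u v : Lp ℝ 2 (P.prod (volume : Measure I))) :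
    toHilbertValued (u + v) = toHilbertValued u + toHilbertValued v := by
  refine Lp.ext ?_
  filter_upwards [toHilbertValued_ae u, toHilbertValued_ae v, toHilbertValued_ae (u + v),
    Lp.coeFn_add (toHilbertValued u) (toHilbertValued v),
    Measure.ae_ae_of_ae_prod (Lp.coeFn_add u v)] with ω h1 h2 h3 h4 h5
  rw [h4, Pi.add_apply]
  refine Lp.ext ?_
  filter_upwards [h1, h2, h3, h5, Lp.coeFn_add (toHilbertValued u ω) (toHilbertValued v ω)]
    with t g1 g2 g3 g5 g6
  rw [g3, g5, g6, Pi.add_apply, Pi.add_apply, g1, g2]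

theorem toHilbertValued_smul (c : ℝ) (u : Lp ℝ 2 (P.prod (volume : Measure I))) :
    toHilbertValued (c • u) = c • toHilbertValued u := by
  refine Lp.ext ?_
  filter_upwards [toHilbertValued_ae u, toHilbertValued_ae (c • u),
    Lp.coeFn_smul c (toHilbertValued u),
    Measure.ae_ae_of_ae_prod (Lp.coeFn_smul c u)] with ω h1 h3 h4 h5
  rw [h4, Pi.smul_apply]
  refine Lp.ext ?_
  filter_upwards [h1, h3, h5, Lp.coeFn_smul c (toHilbertValued u ω)] with t g1 g3 g5 g6
  rw [g3, g5, g6, Pi.smul_apply, Pi.smul_apply, g1]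

theorem norm_toHilbertValued (u : Lp ℝ 2 (P.prod (volume : Measure I))) :
    ‖toHilbertValued u‖ = ‖u‖ := by
  rw [← sq_eq_sq₀ (norm_nonneg _) (norm_nonneg _), Lp_two_norm_sq, ← real_inner_self_eq_norm_sq,
    L2.inner_def, integral_prod _ (Lp.memLp u).integrable_sq]
  refine integral_congr_ae ?_
  filter_upwards [toHilbertValued_ae u] with ω h1
  rw [real_inner_self_eq_norm_sq, Lp_two_norm_sq]
  refine integral_congr_ae ?_
  filter_upwards [h1] with t g1
  rw [g1]

/-- `toHilbertValued` as a linear isometry. -/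
def toHilbertValuedₗᵢ : Lp ℝ 2 (P.prod (volume : Measure I)) →ₗᵢ[ℝ] Lp L2Time 2 P where
  toFun := toHilbertValued
  map_add' := toHilbertValued_add
  map_smul' := toHilbertValued_smul
  norm_map' := norm_toHilbertValued

theorem continuous_toHilbertValued :
    Continuous (toHilbertValued : Lp ℝ 2 (P.prod (volume : Measure I)) → Lp L2Time 2 P) :=
  (toHilbertValuedₗᵢ (P := P)).continuous

end IdentificationIsometry

/-! ### The Itô integral of elementary processes -/

section Elementary

variable {Ω : Type*} [mΩ : MeasurableSpace Ω] {P : Measure Ω} {B : I → Ω → ℝ}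

/-- The indicator function of `(s,t]`, or of `[s,t)`, in `L²(0,1)`. -/
def indicatorInterval (s t : I) : L2Time := indicatorTime t - indicatorTime s

theorem indicatorInterval_ae_eq {s t : I} (hst : s ≤ t) :
    indicatorInterval s t =ᵐ[volume] (Set.Ico s t).indicator 1 := by
  have h1 : ∀ t : I, indicatorTime t =ᵐ[volume] (Set.Iic t).indicator fun _ ↦ (1 : ℝ) :=
    fun t ↦ indicatorConstLp_coeFn
  -- Single times are null, so the choice of open or closed endpoints is immaterial.
  have h2 : ∀ t : I, ∀ᵐ r : I, r ≠ t := fun t ↦ by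
    simp [ae_iff]
  filter_upwards [Lp.coeFn_sub (indicatorTime t) (indicatorTime s), h1 t, h1 s, h2 s, h2 t]
    with r g1 g2 g3 g4 g5
  rw [indicatorInterval, g1, Pi.sub_apply, g2, g3]
  simp only [Set.indicator_apply, Set.mem_Iic, Set.mem_Ico, Pi.one_apply]
  have e1 : r ≤ s ↔ r < s := ⟨fun h ↦ lt_of_le_of_ne h g4, le_of_lt⟩
  have e2 : r ≤ t ↔ r < t := ⟨fun h ↦ lt_of_le_of_ne h g5, le_of_lt⟩
  simp only [e1, e2, ← not_lt (a := r) (b := s)]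
  by_cases a : r < s
  · simp [a, a.trans_le hst]
  · simp [a]

theorem inner_indicatorInterval (r s t : I) :
    inner ℝ (indicatorTime r) (indicatorInterval s t) =
      min (r : ℝ) (t : ℝ) - min (r : ℝ) (s : ℝ) := by
  rw [indicatorInterval, inner_sub_right, inner_indicatorTime, inner_indicatorTime]

theorem wienerIntegral_indicatorInterval (hB : IsBrownianMotion B P) (s t : I) :
    wienerIntegral hB (indicatorInterval s t) =ᵐ[P] fun ω ↦ B t ω - B s ω := by
  rw [indicatorInterval, map_sub, wienerIntegral_indicatorTime, wienerIntegral_indicatorTime]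
  filter_upwards [Lp.coeFn_sub (hB.memLp t).toLp (hB.memLp s).toLp,
    (hB.memLp t).coeFn_toLp, (hB.memLp s).coeFn_toLp] with ω h1 h2 h3
  rw [h1, Pi.sub_apply, h2, h3]

/-- Past and future are orthogonal in L²(0,1). This removes the correction term in the integration
by parts and takes the place of a direct appeal to independent increments. -/
theorem inner_indicatorInterval_of_mem_span {s t : I} (hst : s ≤ t) {g : L2Time}
    (hg : g ∈ Submodule.span ℝ (indicatorTime '' Set.Iic s)) :
    inner ℝ g (indicatorInterval s t) = 0 := by
  induction hg using Submodule.span_induction with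
  | mem g hg =>
    obtain ⟨r, hr, rfl⟩ := hg
    have h1 : (r : ℝ) ≤ s := hr
    have h2 : (s : ℝ) ≤ t := hst
    rw [inner_indicatorInterval, min_eq_left h1, min_eq_left (h1.trans h2), sub_self]
  | zero => exact inner_zero_left _
  | add f g _ _ hf hg => rw [inner_add_left, hf, hg, add_zero]
  | smul c g _ hg => rw [real_inner_smul_left, hg, mul_zero]

theorem isTotal_wienerIntegral (hB : IsBrownianMotion B P)
    (hF : brownianFiltration hB 1 = mΩ) : IsTotal (wienerIntegral hB) :=
  fun _ hX h ↦ ae_eq_zero_of_expIntegral_eq_zero hB hF hX h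

theorem memLp_increment (hB : IsBrownianMotion B P) (s t : I) :
    MemLp (fun ω ↦ B t ω - B s ω) 2 P :=
  (hB.memLp t).sub (hB.memLp s)

theorem hasAllMoments_increment (hB : IsBrownianMotion B P) (s t : I) :
    HasAllMoments (fun ω ↦ B t ω - B s ω) P := fun p hp ↦
  ((isIsonormal_wienerIntegral hB).hasAllMoments (indicatorInterval s t) p hp).ae_eq
    (wienerIntegral_indicatorInterval hB s t)

/-- Conditional integration by parts: `E[Y ⟨DF, 1_{[s,t)}⟩] = E[Y F (B_t - B_s)]` for
`𝓕_s`-measurable `Y`. -/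
theorem integral_mul_inner_indicatorInterval (hB : IsBrownianMotion B P) {F : Lp ℝ 2 P}
    {G : Lp L2Time 2 P} (h : IsPolynomialWithDerivative (wienerIntegral hB) F G) {s t : I}
    (hst : s ≤ t) {Y : Ω → ℝ} (hY : AEStronglyMeasurable[brownianFiltration hB s] Y P)
    (hY2 : MemLp Y 2 P) :
    ∫ ω, Y ω * inner ℝ (G ω) (indicatorInterval s t) ∂P =
      ∫ ω, Y ω * (F ω * (B t ω - B s ω)) ∂P := by
  have := hB.isProbabilityMeasure
  have hW := isIsonormal_wienerIntegral hB
  have h1 := memLp_inner_const G (indicatorInterval s t)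
  have h2 : MemLp (fun ω ↦ F ω * (B t ω - B s ω)) 2 P :=
    ((h.hasAllMoments hW).mul (hasAllMoments_increment hB s t)) 2 ENNReal.ofNat_ne_top
  have i1 : Integrable (fun ω ↦ Y ω * inner ℝ (G ω) (indicatorInterval s t)) P :=
    hY2.integrable_mul h1
  have i2 : Integrable (fun ω ↦ Y ω * (F ω * (B t ω - B s ω))) P := hY2.integrable_mul h2
  rw [← sub_eq_zero, ← integral_sub i1 i2]
  simp only [← mul_sub]
  have h12 := h1.sub h2
  -- The difference ⟨DF, 1_{[s,t)}⟩ - F (B_t - B_s) has zero conditional expectation given 𝓕_s,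
  -- which is tested on exponentials of the past.
  refine integral_mul_eq_zero_of_forall_setIntegral_eq_zero ((brownianFiltration hB).le s)
    (h12.integrable (by norm_num)) (fun A hA ↦ ?_) hY (hY2.integrable_mul h12)
  refine setIntegral_eq_zero_of_expIntegral_eq_zero hB s (h12.integrable (by norm_num))
    (fun g hg ↦ ?_) hA
  have e1 : (fun ω ↦ inner ℝ (G ω) (indicatorInterval s t)) - (fun ω ↦ F ω * (B t ω - B s ω))
      =ᵐ[P] fun ω ↦ inner ℝ (G ω) (indicatorInterval s t) +
        (-1) * (F ω * wienerIntegral hB (indicatorInterval s t) ω) := by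
    filter_upwards [wienerIntegral_indicatorInterval hB s t] with ω hω
    rw [Pi.sub_apply, hω]
    ring
  have h3 : Integrable (fun ω ↦ (-1) * (F ω * wienerIntegral hB (indicatorInterval s t) ω)) P :=
    ((Lp.memLp F).integrable_mul (Lp.memLp _)).const_mul _
  rw [expIntegral_congr e1, expIntegral_add (h1.integrable (by norm_num)) h3,
    expIntegral_const_mul, h.expIntegral_inner hW, inner_indicatorInterval_of_mem_span hst hg]
  push_cast
  ring

theorem IsElementaryIto.toHilbertValued_ae_eq [IsProbabilityMeasure P] {N : ℕ} {s t : Fin N → I}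
    {Y : Fin N → Ω → ℝ} (hst : ∀ k, s k < t k) {u : Lp ℝ 2 (P.prod (volume : Measure I))}
    (hu : ∀ᵐ z ∂(P.prod (volume : Measure I)),
      u z = ∑ k, Y k z.1 * (Set.Ico (s k) (t k)).indicator 1 z.2) :
    toHilbertValued u =ᵐ[P] fun ω ↦ ∑ k, Y k ω • indicatorInterval (s k) (t k) := by
  filter_upwards [toHilbertValued_ae u, Measure.ae_ae_of_ae_prod hu] with ω h1 h2
  refine Lp.ext ?_
  have h3 : ∀ᵐ r : I, ∀ k ∈ Finset.univ, (Y k ω • indicatorInterval (s k) (t k) : L2Time) r =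
      Y k ω * (Set.Ico (s k) (t k)).indicator 1 r := by
    refine (ae_ball_iff (Finset.univ.countable_toSet)).2 fun k _ ↦ ?_
    filter_upwards [Lp.coeFn_smul (Y k ω) (indicatorInterval (s k) (t k)),
      indicatorInterval_ae_eq (hst k).le] with r g1 g2
    rw [g1, Pi.smul_apply, g2, smul_eq_mul]
  filter_upwards [h1, h2, h3,
    Lp.coeFn_finsetSum Finset.univ fun k ↦ Y k ω • indicatorInterval (s k) (t k)]
    with r g1 g2 g3 g4
  rw [g1, g2, g4, Finset.sum_apply]
  exact (Finset.sum_congr rfl g3).symm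

theorem IsElementaryIto.inner_eq [IsProbabilityMeasure P] {hB : IsBrownianMotion B P}
    {u : Lp ℝ 2 (P.prod (volume : Measure I))} {X : Lp ℝ 2 P} (hu : IsElementaryIto hB u X)
    {F : Lp ℝ 2 P} {G : Lp L2Time 2 P}
    (h : IsPolynomialWithDerivative (wienerIntegral hB) F G) :
    inner ℝ X F = inner ℝ (toHilbertValued u) G := by
  obtain ⟨N, s, t, Y, hst, hYm, hY2, hu, hX⟩ := hu
  have hm := h.hasAllMoments (isIsonormal_wienerIntegral hB)
  have e1 : inner ℝ X F = ∫ ω, ∑ k, Y k ω * (F ω * (B (t k) ω - B (s k) ω)) ∂P := by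
    rw [L2.inner_def]
    refine integral_congr_ae ?_
    filter_upwards [hX] with ω hω
    simp only [hω, RCLike.inner_apply, conj_trivial, Finset.mul_sum]
    exact Finset.sum_congr rfl fun k _ ↦ by ring
  have e2 : inner ℝ (toHilbertValued u) G =
      ∫ ω, ∑ k, Y k ω * inner ℝ (G ω) (indicatorInterval (s k) (t k)) ∂P := by
    rw [L2.inner_def]
    refine integral_congr_ae ?_
    filter_upwards [IsElementaryIto.toHilbertValued_ae_eq hst hu] with ω hω
    rw [real_inner_comm, hω, inner_sum]
    simp only [real_inner_smul_right]
  rw [e1, e2, integral_finsetSum, integral_finsetSum]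
  · exact Finset.sum_congr rfl fun k _ ↦ (integral_mul_inner_indicatorInterval hB h (hst k).le
      (hYm k).aestronglyMeasurable (hY2 k)).symm
  · exact fun k _ ↦ (hY2 k).integrable_mul (memLp_inner_const G _)
  · exact fun k _ ↦ (hY2 k).integrable_mul
      ((hm.mul (hasAllMoments_increment hB (s k) (t k))) 2 ENNReal.ofNat_ne_top)

/-- Both sides of the duality are continuous in (u, X), so it passes from elementary processes to
their L² limits. -/
theorem IsItoIntegral.inner_eq [IsProbabilityMeasure P] {hB : IsBrownianMotion B P}
    {u : Lp ℝ 2 (P.prod (volume : Measure I))} {X : Lp ℝ 2 P} (hu : IsItoIntegral hB u X)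
    {F : Lp ℝ 2 P} {G : Lp L2Time 2 P}
    (h : IsPolynomialWithDerivative (wienerIntegral hB) F G) :
    inner ℝ X F = inner ℝ (toHilbertValued u) G := by
  obtain ⟨un, Xn, he, hun, hXn⟩ := hu
  refine tendsto_nhds_unique (hXn.inner tendsto_const_nhds) ?_
  have := ((continuous_toHilbertValued.tendsto u).comp hun).inner (𝕜 := ℝ)
    (tendsto_const_nhds (x := G))
  exact this.congr fun n ↦ ((he n).inner_eq h).symm

end Elementary

/-! ### The Itô isometry -/

section Isometry

variable {Ω : Type*} [mΩ : MeasurableSpace Ω] {P : Measure Ω} {B : I → Ω → ℝ}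

/-- `E[Y W(k) (B_t - B_s)] = E[Y] ⟨k, 1_{[s,t)}⟩` for `𝓕_s`-measurable `Y`. -/
theorem integral_mul_wiener_mul_increment (hB : IsBrownianMotion B P) (k : L2Time) {s t : I}
    (hst : s ≤ t) {Y : Ω → ℝ} (hY : AEStronglyMeasurable[brownianFiltration hB s] Y P)
    (hY2 : MemLp Y 2 P) :
    ∫ ω, Y ω * (wienerIntegral hB k ω * (B t ω - B s ω)) ∂P =
      (∫ ω, Y ω ∂P) * inner ℝ k (indicatorInterval s t) := by
  have := hB.isProbabilityMeasure
  -- The polynomial is a single variable: F = W(k) has the constant derivative k.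
  obtain ⟨F, G, hFG, hF, hG⟩ := exists_isPolynomialWithDerivative (isIsonormal_wienerIntegral hB)
    (MvPolynomial.X (0 : Fin 1)) fun _ ↦ k
  have key := integral_mul_inner_indicatorInterval hB hFG hst hY hY2
  rw [← integral_mul_const]
  refine Eq.trans (integral_congr_ae ?_) (key.symm.trans (integral_congr_ae ?_))
  · filter_upwards [hF] with ω hω
    simp [hω, polyEval]
  · filter_upwards [hG (indicatorInterval s t)] with ω hω
    simp [hω, polyDeriv]

/-- `u = 1_A 1_{[s,t)}` with `A ∈ 𝓕_s`, and `X = 1_A (B_t - B_s)`. -/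
def IsSimpleIto [IsProbabilityMeasure P] (hB : IsBrownianMotion B P)
    (x : Lp ℝ 2 (P.prod (volume : Measure I)) × Lp ℝ 2 P) : Prop :=
  ∃ (s t : I) (A : Set Ω), s < t ∧ MeasurableSet[brownianFiltration hB s] A ∧
    (∀ᵐ z ∂(P.prod (volume : Measure I)),
      x.1 z = A.indicator 1 z.1 * (Set.Ico s t).indicator 1 z.2) ∧
    (∀ᵐ ω ∂P, x.2 ω = A.indicator 1 ω * (B t ω - B s ω))

variable [IsProbabilityMeasure P]

theorem toHilbertValued_ae_eq_smul_indicatorInterval {s t : I} {A : Set Ω} (hst : s < t)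
    {u : Lp ℝ 2 (P.prod (volume : Measure I))}
    (hu : ∀ᵐ z ∂(P.prod (volume : Measure I)),
      u z = A.indicator 1 z.1 * (Set.Ico s t).indicator 1 z.2) :
    toHilbertValued u =ᵐ[P] fun ω ↦ A.indicator (1 : Ω → ℝ) ω • indicatorInterval s t := by
  simpa using IsElementaryIto.toHilbertValued_ae_eq (s := fun _ : Fin 1 ↦ s) (t := fun _ ↦ t)
    (Y := fun _ ↦ A.indicator 1) (fun _ ↦ hst) (u := u) (by simpa using hu)

theorem memLp_indicator_one {A : Set Ω} (hA : MeasurableSet A) :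
    MemLp (A.indicator (1 : Ω → ℝ)) 2 P :=
  (memLp_const (1 : ℝ)).indicator hA

theorem IsSimpleIto.inner_eq {hB : IsBrownianMotion B P}
    {x y : Lp ℝ 2 (P.prod (volume : Measure I)) × Lp ℝ 2 P}
    (hx : IsSimpleIto hB x) (hy : IsSimpleIto hB y) :
    inner ℝ x.2 y.2 = inner ℝ x.1 y.1 := by
  obtain ⟨s, t, A, hst, hA, hu, hX⟩ := hx
  obtain ⟨s', t', A', hst', hA', hu', hX'⟩ := hy
  wlog hs : s ≤ s' generalizing x y s t A s' t' A'
  · rw [real_inner_comm, this s' t' A' hst' hA' hu' hX' s t A hst hA hu hX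
      (le_of_not_ge hs), real_inner_comm]
  -- With s ≤ s', both events are known at time s'. The earlier increment is W(k) with k the
  -- indicator of [s,t), so nothing has to be assumed about how the intervals overlap.
  have hm : MeasurableSet[brownianFiltration hB s'] (A ∩ A') :=
    ((brownianFiltration hB).mono hs _ hA).inter hA'
  have e0 : ∀ ω, (A ∩ A').indicator (1 : Ω → ℝ) ω = A.indicator 1 ω * A'.indicator 1 ω :=
    fun ω ↦ by simp [Set.inter_indicator_one]
  have hY : StronglyMeasurable[brownianFiltration hB s'] ((A ∩ A').indicator (1 : Ω → ℝ)) :=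
    stronglyMeasurable_one.indicator hm
  have hY2 : MemLp ((A ∩ A').indicator (1 : Ω → ℝ)) 2 P :=
    memLp_indicator_one ((brownianFiltration hB).le s' _ hm)
  have e1 : inner ℝ x.2 y.2 = ∫ ω, (A ∩ A').indicator 1 ω *
      (wienerIntegral hB (indicatorInterval s t) ω * (B t' ω - B s' ω)) ∂P := by
    rw [L2.inner_def]
    refine integral_congr_ae ?_
    filter_upwards [hX, hX', wienerIntegral_indicatorInterval hB s t] with ω h1 h2 h3
    rw [h1, h2, h3, e0]
    simp only [RCLike.inner_apply, conj_trivial]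
    ring
  have e2 : inner ℝ x.1 y.1 = ∫ ω, (A ∩ A').indicator 1 ω *
      inner ℝ (indicatorInterval s t) (indicatorInterval s' t') ∂P := by
    rw [← (toHilbertValuedₗᵢ (P := P)).inner_map_map, L2.inner_def]
    refine integral_congr_ae ?_
    filter_upwards [toHilbertValued_ae_eq_smul_indicatorInterval hst hu,
      toHilbertValued_ae_eq_smul_indicatorInterval hst' hu'] with ω h1 h2
    change inner ℝ (toHilbertValued x.1 ω) (toHilbertValued y.1 ω) = _
    rw [h1, h2, e0, real_inner_smul_left, real_inner_smul_right]
    ring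
  rw [e1, e2, integral_mul_wiener_mul_increment hB _ hst'.le hY.aestronglyMeasurable hY2,
    integral_mul_const]

/-- The linear span of the pairs `(1_A 1_{[s,t)}, 1_A (B_t - B_s))`. -/
def simpleIto (hB : IsBrownianMotion B P) :
    Submodule ℝ (Lp ℝ 2 (P.prod (volume : Measure I)) × Lp ℝ 2 P) :=
  Submodule.span ℝ {x | IsSimpleIto hB x}

theorem inner_eq_of_mem_simpleIto {hB : IsBrownianMotion B P}
    {x y : Lp ℝ 2 (P.prod (volume : Measure I)) × Lp ℝ 2 P}
    (hx : x ∈ simpleIto hB) (hy : y ∈ simpleIto hB) : inner ℝ x.2 y.2 = inner ℝ x.1 y.1 := by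
  induction hx, hy using Submodule.span_induction₂ with
  | mem_mem x y hx hy => exact IsSimpleIto.inner_eq hx hy
  | zero_left y hy => simp only [Prod.fst_zero, Prod.snd_zero, inner_zero_left]
  | zero_right x hx => simp only [Prod.fst_zero, Prod.snd_zero, inner_zero_right]
  | add_left x y z _ _ _ h1 h2 =>
    simp only [Prod.fst_add, Prod.snd_add, inner_add_left, h1, h2]
  | add_right x y z _ _ _ h1 h2 =>
    simp only [Prod.fst_add, Prod.snd_add, inner_add_right, h1, h2]
  | smul_left r x y _ _ h =>
    simp only [Prod.smul_fst, Prod.smul_snd, real_inner_smul_left, h]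
  | smul_right r x y _ _ h =>
    simp only [Prod.smul_fst, Prod.smul_snd, real_inner_smul_right, h]

theorem norm_eq_of_mem_simpleIto {hB : IsBrownianMotion B P}
    {x : Lp ℝ 2 (P.prod (volume : Measure I)) × Lp ℝ 2 P} (hx : x ∈ simpleIto hB) :
    ‖x.2‖ = ‖x.1‖ := by
  rw [← sq_eq_sq₀ (norm_nonneg _) (norm_nonneg _), ← real_inner_self_eq_norm_sq,
    ← real_inner_self_eq_norm_sq, inner_eq_of_mem_simpleIto hx hx]

theorem norm_sub_eq_of_mem_simpleIto {hB : IsBrownianMotion B P}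
    {x y : Lp ℝ 2 (P.prod (volume : Measure I)) × Lp ℝ 2 P} (hx : x ∈ simpleIto hB)
    (hy : y ∈ simpleIto hB) : ‖x.2 - y.2‖ = ‖x.1 - y.1‖ := by
  have h := norm_eq_of_mem_simpleIto (Submodule.sub_mem _ hx hy)
  rwa [Prod.fst_sub, Prod.snd_sub] at h

theorem Lp_coeFn_sum_smul {α ι : Type*} [MeasurableSpace α] {μ : Measure α} (s : Finset ι)
    (c : ι → ℝ) (f : ι → Lp ℝ 2 μ) :
    (∑ i ∈ s, c i • f i : Lp ℝ 2 μ) =ᵐ[μ] fun x ↦ ∑ i ∈ s, c i * f i x := by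
  have h : ∀ᵐ x ∂μ, ∀ i ∈ s, (c i • f i : Lp ℝ 2 μ) x = c i * f i x :=
    (ae_ball_iff s.countable_toSet).2 fun i _ ↦ Lp.coeFn_smul (c i) (f i)
  filter_upwards [Lp.coeFn_finsetSum s fun i ↦ c i • f i, h] with x h1 h2
  rw [h1, Finset.sum_apply]
  exact Finset.sum_congr rfl h2

theorem isElementaryIto_of_mem_simpleIto {hB : IsBrownianMotion B P}
    {x : Lp ℝ 2 (P.prod (volume : Measure I)) × Lp ℝ 2 P} (hx : x ∈ simpleIto hB) :
    IsElementaryIto hB x.1 x.2 := by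
  obtain ⟨N, c, y, rfl⟩ := Submodule.mem_span_set'.1 hx
  choose s t A hst hA hu hX using fun i ↦ (y i).2
  refine ⟨N, s, t, fun i ω ↦ c i * (A i).indicator 1 ω, hst,
    fun i ↦ (stronglyMeasurable_one.indicator (hA i)).const_mul (c i),
    fun i ↦ (memLp_indicator_one ((brownianFiltration hB).le _ _ (hA i))).const_mul (c i), ?_, ?_⟩
  · simp only [Prod.fst_sum, Prod.smul_fst]
    filter_upwards [Lp_coeFn_sum_smul Finset.univ c fun i ↦ (y i).1.1, ae_all_iff.2 hu]
      with z h1 h2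
    rw [h1]
    exact Finset.sum_congr rfl fun i _ ↦ by rw [h2, mul_assoc]
  · simp only [Prod.snd_sum, Prod.smul_snd]
    filter_upwards [Lp_coeFn_sum_smul Finset.univ c fun i ↦ (y i).1.2, ae_all_iff.2 hX]
      with z h1 h2
    rw [h1]
    exact Finset.sum_congr rfl fun i _ ↦ by rw [h2, mul_assoc]

/-- By the isometry, integrals of a convergent sequence of simple processes form a Cauchy sequence
in L²(Ω). -/
theorem exists_isItoIntegral_of_mem_closure {hB : IsBrownianMotion B P}
    {u : Lp ℝ 2 (P.prod (volume : Measure I))}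
    (hu : u ∈ ((simpleIto hB).map (LinearMap.fst ℝ _ _)).topologicalClosure) :
    ∃ X, IsItoIntegral hB u X := by
  rw [← SetLike.mem_coe, Submodule.topologicalClosure_coe] at hu
  obtain ⟨un, hun, hlim⟩ := mem_closure_iff_seq_limit.1 hu
  choose x hx hxu using hun
  replace hxu : ∀ n, (x n).1 = un n := hxu
  have hcau : CauchySeq fun n ↦ (x n).2 := by
    have hd : ∀ m n, dist (x m).2 (x n).2 = dist (un m) (un n) := fun m n ↦ by
      rw [dist_eq_norm, dist_eq_norm, ← hxu m, ← hxu n]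
      exact norm_sub_eq_of_mem_simpleIto (hx m) (hx n)
    rw [Metric.cauchySeq_iff]
    simpa only [hd] using Metric.cauchySeq_iff.1 hlim.cauchySeq
  obtain ⟨X, hX⟩ := cauchySeq_tendsto_of_complete hcau
  refine ⟨X, un, fun n ↦ (x n).2, fun n ↦ ?_, hlim, hX⟩
  rw [← hxu n]
  exact isElementaryIto_of_mem_simpleIto (hx n)

theorem exists_isSimpleIto (hB : IsBrownianMotion B P) {s t : I} (hst : s < t) {A : Set Ω}
    (hA : MeasurableSet[brownianFiltration hB s] A) :
    ∃ x : Lp ℝ 2 (P.prod (volume : Measure I)) × Lp ℝ 2 P, IsSimpleIto hB x ∧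
      ∀ᵐ z ∂(P.prod (volume : Measure I)),
        x.1 z = A.indicator 1 z.1 * (Set.Ico s t).indicator 1 z.2 := by
  classical
  have hA' := (brownianFiltration hB).le s _ hA
  have h2 : MemLp (A.indicator fun ω ↦ B t ω - B s ω) 2 P := (memLp_increment hB s t).indicator hA'
  have h1 : ∀ᵐ z ∂(P.prod (volume : Measure I)),
      indicatorConstLp 2 (hA'.prod measurableSet_Ico)
        (measure_ne_top (P.prod (volume : Measure I)) (A ×ˢ Set.Ico s t)) (1 : ℝ) z = A.indicator 1 z.1 * (Set.Ico s t).indicator 1 z.2 := by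
    filter_upwards [indicatorConstLp_coeFn (p := 2) (hs := hA'.prod measurableSet_Ico)
      (hμs := measure_ne_top (P.prod (volume : Measure I)) (A ×ˢ Set.Ico s t)) (c := (1 : ℝ))]
      with z hz
    rw [hz]
    by_cases h : z.1 ∈ A <;> simp [Set.indicator_apply, h]
  refine ⟨(_, h2.toLp), ⟨s, t, A, hst, hA, h1, ?_⟩, h1⟩
  filter_upwards [h2.coeFn_toLp] with ω hω
  rw [hω]
  simp [Set.indicator_apply]

end Isometry

/-! ### Density of the simple processes in `L²_a` -/

section Density

theorem ae_ae_of_ae_prod_swap {α β : Type*} [MeasurableSpace α] [MeasurableSpace β]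
    {μ : Measure α} {ν : Measure β} [SFinite μ] [SFinite ν] {p : α × β → Prop}
    (h : ∀ᵐ z ∂μ.prod ν, p z) : ∀ᵐ y ∂ν, ∀ᵐ x ∂μ, p (x, y) := by
  rw [← Measure.prod_swap] at h
  exact Measure.ae_ae_of_ae_prod (ae_of_ae_map measurable_swap.aemeasurable h)

/-- Convergence holds off a set that is null in the large σ-algebra but perhaps not in m. Taking
`limUnder` of m-measurable versions gives an m-measurable function everywhere. -/
theorem aestronglyMeasurable_of_tendsto_ae_of_le {α : Type*} {m m0 : MeasurableSpace α}
    {μ : Measure α} {f : ℕ → α → ℝ} {g : α → ℝ} (hf : ∀ n, AEStronglyMeasurable[m] (f n) μ)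
    (h : ∀ᵐ x ∂μ, Tendsto (fun n ↦ f n x) atTop (𝓝 (g x))) : AEStronglyMeasurable[m] g μ := by
  choose F hF hfF using hf
  refine ⟨fun x ↦ limUnder atTop fun n ↦ F n x, @StronglyMeasurable.limUnder _ _ _ m _ _ _ _ _ _ _ hF, ?_⟩
  filter_upwards [h, ae_all_iff.2 hfF] with x h1 h2
  simp only [h2] at h1
  exact h1.limUnder_eq.symm

/-- Write the square as a double integral; the diagonal is null for an atomless measure, and the two
triangles contribute equally by symmetry. -/
theorem integral_sq_eq_two_mul_integral_Ioi {μ : Measure I} [IsFiniteMeasure μ]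
    (hμ : ∀ x, μ {x} = 0) {f : I → ℝ} (hf : Integrable f μ) :
    (∫ r, f r ∂μ) ^ 2 = 2 * ∫ r, f r * ∫ q in Set.Ioi r, f q ∂μ ∂μ := by
  have hff : Integrable (fun z : I × I ↦ f z.1 * f z.2) (μ.prod μ) := hf.mul_prod hf
  have hlt : MeasurableSet {z : I × I | z.1 < z.2} := measurableSet_lt measurable_fst measurable_snd
  have hgt : MeasurableSet {z : I × I | z.2 < z.1} := measurableSet_lt measurable_snd measurable_fst
  have hdiag : ∀ᵐ z ∂μ.prod μ, z.1 ≠ z.2 := by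
    refine (Measure.ae_prod_iff_ae_ae ?_).2 (ae_of_all _ fun x ↦ ?_)
    · exact (measurableSet_eq_fun measurable_fst measurable_snd).compl
    · have := hμ x
      rw [ae_iff]
      simpa [eq_comm] using this
  have e1 : ∫ z, f z.1 * f z.2 ∂μ.prod μ =
      ∫ z, {z : I × I | z.1 < z.2}.indicator (fun z ↦ f z.1 * f z.2) z ∂μ.prod μ +
      ∫ z, {z : I × I | z.2 < z.1}.indicator (fun z ↦ f z.1 * f z.2) z ∂μ.prod μ := by
    rw [← integral_add (hff.indicator hlt) (hff.indicator hgt)]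
    refine integral_congr_ae ?_
    filter_upwards [hdiag] with z hz
    rcases lt_or_gt_of_ne hz with h | h
    · simp [h, not_lt_of_gt h]
    · simp [h, not_lt_of_gt h]
  have e2 : ∫ z, {z : I × I | z.2 < z.1}.indicator (fun z ↦ f z.1 * f z.2) z ∂μ.prod μ =
      ∫ z, {z : I × I | z.1 < z.2}.indicator (fun z ↦ f z.1 * f z.2) z ∂μ.prod μ := by
    rw [← integral_prod_swap]
    refine integral_congr_ae (ae_of_all _ fun z ↦ ?_)
    simp [Set.indicator_apply, mul_comm]
  have e3 : ∫ z, {z : I × I | z.1 < z.2}.indicator (fun z ↦ f z.1 * f z.2) z ∂μ.prod μ =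
      ∫ r, f r * ∫ q in Set.Ioi r, f q ∂μ ∂μ := by
    rw [integral_prod _ (hff.indicator hlt)]
    refine integral_congr_ae (ae_of_all _ fun r ↦ ?_)
    beta_reduce
    rw [← integral_const_mul, ← integral_indicator measurableSet_Ioi]
    refine integral_congr_ae (ae_of_all _ fun q ↦ ?_)
    simp [Set.indicator_apply]
  rw [pow_two, ← integral_prod_mul, e1, e2, e3]
  ring

theorem inner_indicatorTime_left (t : I) (f : L2Time) :
    inner ℝ (indicatorTime t) f = ∫ r in Set.Iic t, f r := by
  rw [indicatorTime, L2.inner_indicatorConstLp_one]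

theorem inner_indicatorInterval_left {s t : I} (hst : s ≤ t) (f : L2Time) :
    inner ℝ (indicatorInterval s t) f = ∫ r in Set.Ioc s t, f r := by
  have hf : Integrable f (volume : Measure I) := (Lp.memLp f).integrable (by norm_num)
  have h : Set.Ioc s t = Set.Iic t \ Set.Iic s := by
    ext r
    simp [and_comm]
  rw [indicatorInterval, inner_sub_left, inner_indicatorTime_left, inner_indicatorTime_left,
    h, setIntegral_sdiff measurableSet_Iic hf.integrableOn (Set.Iic_subset_Iic.2 hst)]

theorem inner_indicatorTime_sq (t : I) (f : L2Time) :
    inner ℝ (indicatorTime t) f ^ 2 =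
      2 * ∫ r in Set.Iic t, f r * inner ℝ (indicatorInterval r t) f := by
  have hf : Integrable f (volume : Measure I) := (Lp.memLp f).integrable (by norm_num)
  rw [inner_indicatorTime_left, integral_sq_eq_two_mul_integral_Ioi (fun x ↦ ?_) hf.restrict]
  · congr 1
    refine setIntegral_congr_fun measurableSet_Iic fun r hr ↦ ?_
    rw [inner_indicatorInterval_left hr, Measure.restrict_restrict measurableSet_Ioi,
      Set.Ioi_inter_Iic]
  · exact measure_mono_null (Set.singleton_subset_singleton.2 rfl)
      (le_antisymm ((Measure.restrict_apply_le _ _).trans (by simp)) bot_le)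

theorem norm_indicatorTime_sub_sq (s t : I) :
    ‖indicatorTime s - indicatorTime t‖ ^ 2 = |(s : ℝ) - t| := by
  rw [← real_inner_self_eq_norm_sq, inner_sub_left, inner_sub_right, inner_sub_right]
  simp only [inner_indicatorTime, min_self]
  rcases le_total (s : ℝ) t with h | h
  · rw [min_eq_left h, min_eq_right h, abs_of_nonpos (by linarith)]
    ring
  · rw [min_eq_right h, min_eq_left h, abs_of_nonneg (by linarith)]
    ring

/-- Needed for joint measurability of (ω,r) ↦ ⟨1_{[r,t)}, w(ω,·)⟩ in the Fubini step. -/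
theorem continuous_indicatorTime : Continuous indicatorTime := by
  refine continuous_iff_continuousAt.2 fun t ↦ ?_
  rw [ContinuousAt, tendsto_iff_norm_sub_tendsto_zero]
  have h : ∀ s, ‖indicatorTime s - indicatorTime t‖ = √|(s : ℝ) - t| := fun s ↦ by
    rw [← norm_indicatorTime_sub_sq, Real.sqrt_sq (norm_nonneg _)]
  simp only [h]
  have hc : Continuous fun s : I ↦ √|(s : ℝ) - t| := by fun_prop
  simpa using hc.tendsto t

theorem norm_indicatorInterval_le (s t : I) : ‖indicatorInterval s t‖ ≤ 1 := by
  rw [← sq_le_one_iff₀ (norm_nonneg _), indicatorInterval, norm_indicatorTime_sub_sq, abs_le]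
  constructor <;> linarith [s.2.1, s.2.2, t.2.1, t.2.2]

/-! ### Adaptedness up to null sets and the orthogonality argument. -/

variable {Ω : Type*} [mΩ : MeasurableSpace Ω] {P : Measure Ω} [IsProbabilityMeasure P]
  {B : I → Ω → ℝ}

/-- Processes whose value at almost every time `t` is a.e. equal to an `𝓕_t`-measurable random
variable. -/
def IsAEAdapted (hB : IsBrownianMotion B P) (u : Lp ℝ 2 (P.prod (volume : Measure I))) : Prop :=
  ∀ᵐ t : I, AEStronglyMeasurable[brownianFiltration hB t] (fun ω ↦ u (ω, t)) P

theorem isAEAdapted_of_mem_adaptedL2 {hB : IsBrownianMotion B P}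
    {u : Lp ℝ 2 (P.prod (volume : Measure I))} (hu : u ∈ adaptedL2 hB) : IsAEAdapted hB u := by
  obtain ⟨v, hv, huv⟩ := hu
  filter_upwards [ae_ae_of_ae_prod_swap huv] with t ht
  exact ⟨v t, hv t, ht⟩

/-- Some subsequence converges almost everywhere, hence on almost every time slice. This is where
the time-by-time notion pays off: no adapted version valid at all times has to be built. -/
theorem IsAEAdapted.of_tendsto {hB : IsBrownianMotion B P}
    {un : ℕ → Lp ℝ 2 (P.prod (volume : Measure I))} {u : Lp ℝ 2 (P.prod (volume : Measure I))}
    (h : ∀ n, IsAEAdapted hB (un n)) (hlim : Tendsto un atTop (𝓝 u)) : IsAEAdapted hB u := by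
  obtain ⟨ns, -, hns⟩ := (tendstoInMeasure_of_tendsto_Lp hlim).exists_seq_tendsto_ae
  filter_upwards [ae_ae_of_ae_prod_swap hns, ae_all_iff.2 h] with t h1 h2
  exact aestronglyMeasurable_of_tendsto_ae_of_le (fun n ↦ h2 (ns n)) h1

theorem IsAEAdapted.sub {hB : IsBrownianMotion B P}
    {u v : Lp ℝ 2 (P.prod (volume : Measure I))} (hu : IsAEAdapted hB u)
    (hv : IsAEAdapted hB v) : IsAEAdapted hB (u - v) := by
  filter_upwards [hu, hv, ae_ae_of_ae_prod_swap (Lp.coeFn_sub u v)] with t h1 h2 h3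
  exact (h1.sub h2).congr (EventuallyEq.symm h3)

theorem isAEAdapted_of_mem_simpleIto {hB : IsBrownianMotion B P}
    {x : Lp ℝ 2 (P.prod (volume : Measure I)) × Lp ℝ 2 P} (hx : x ∈ simpleIto hB) :
    IsAEAdapted hB x.1 := by
  obtain ⟨N, s, t, Y, hst, hYm, hY2, hu, hX⟩ := isElementaryIto_of_mem_simpleIto hx
  filter_upwards [ae_ae_of_ae_prod_swap hu] with r hr
  refine StronglyMeasurable.aestronglyMeasurable ?_ |>.congr (EventuallyEq.symm hr)
  refine Finset.stronglyMeasurable_fun_sum _ fun k _ ↦ ?_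
  by_cases hk : r ∈ Set.Ico (s k) (t k)
  · simpa [hk] using (hYm k).mono ((brownianFiltration hB).mono hk.1)
  · simpa [hk] using stronglyMeasurable_const

theorem isAEAdapted_of_mem_closure {hB : IsBrownianMotion B P}
    {u : Lp ℝ 2 (P.prod (volume : Measure I))}
    (hu : u ∈ ((simpleIto hB).map (LinearMap.fst ℝ _ _)).topologicalClosure) :
    IsAEAdapted hB u := by
  rw [← SetLike.mem_coe, Submodule.topologicalClosure_coe] at hu
  obtain ⟨un, hun, hlim⟩ := mem_closure_iff_seq_limit.1 hu
  refine IsAEAdapted.of_tendsto (fun n ↦ ?_) hlim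
  obtain ⟨x, hx, hxu⟩ := hun n
  rw [← hxu]
  exact isAEAdapted_of_mem_simpleIto hx

theorem integral_mul_inner_eq_zero_of_orthogonal {hB : IsBrownianMotion B P}
    {w : Lp ℝ 2 (P.prod (volume : Measure I))}
    (hw : w ∈ ((simpleIto hB).map (LinearMap.fst ℝ _ _))ᗮ) {s t : I} (hst : s ≤ t) {Y : Ω → ℝ}
    (hY : AEStronglyMeasurable[brownianFiltration hB s] Y P) (hY2 : MemLp Y 2 P) :
    ∫ ω, Y ω * inner ℝ (indicatorInterval s t) (toHilbertValued w ω) ∂P = 0 := by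
  -- Simple processes require s < t; an empty interval contributes zero.
  rcases hst.eq_or_lt with rfl | hst
  · simp [indicatorInterval]
  have hZ : MemLp (fun ω ↦ inner ℝ (indicatorInterval s t) (toHilbertValued w ω)) 2 P :=
    (Lp.memLp (toHilbertValued w)).const_inner _
  refine integral_mul_eq_zero_of_forall_setIntegral_eq_zero ((brownianFiltration hB).le s)
    (hZ.integrable (by norm_num)) (fun A hA ↦ ?_) hY (hY2.integrable_mul hZ)
  obtain ⟨x, hx, hxA⟩ := exists_isSimpleIto hB hst hA
  have h0 := hw x.1 ⟨x, Submodule.subset_span hx, rfl⟩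
  rw [← (toHilbertValuedₗᵢ (P := P)).inner_map_map, L2.inner_def] at h0
  rw [← h0, ← integral_indicator ((brownianFiltration hB).le s _ hA)]
  refine integral_congr_ae ?_
  filter_upwards [toHilbertValued_ae_eq_smul_indicatorInterval hst hxA] with ω hω
  change _ = inner ℝ (toHilbertValued x.1 ω) (toHilbertValued w ω)
  rw [hω, real_inner_smul_left]
  by_cases h : ω ∈ A <;> simp [h]

/-- The second factor is bounded by ‖w(ω,·)‖, so this is a product of two functions in L²(Ω ×
(0,1)). -/
theorem integrable_mul_inner_indicatorInterval (w : Lp ℝ 2 (P.prod (volume : Measure I)))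
    (t : I) : Integrable (fun z : Ω × I ↦
      w z * inner ℝ (indicatorInterval z.2 t) (toHilbertValued w z.1))
      (P.prod (volume : Measure I)) := by
  have hU : MemLp (fun z : Ω × I ↦ toHilbertValued w z.1) 2 (P.prod (volume : Measure I)) :=
    (Lp.memLp (toHilbertValued w)).comp_fst _
  have hc : Continuous fun r : I ↦ indicatorInterval r t :=
    continuous_const.sub continuous_indicatorTime
  have hm : AEStronglyMeasurable (fun z : Ω × I ↦
      inner ℝ (indicatorInterval z.2 t) (toHilbertValued w z.1)) (P.prod (volume : Measure I)) :=
    (hc.comp_stronglyMeasurable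
      measurable_snd.stronglyMeasurable).aestronglyMeasurable.inner hU.1
  refine (Lp.memLp w).integrable_mul (hU.mono hm (ae_of_all _ fun z ↦ ?_))
  refine (norm_inner_le_norm _ _).trans ?_
  exact mul_le_of_le_one_left (norm_nonneg _) (norm_indicatorInterval_le _ _)

theorem inner_indicatorTime_ae_eq_zero {hB : IsBrownianMotion B P}
    {w : Lp ℝ 2 (P.prod (volume : Measure I))} (hwa : IsAEAdapted hB w)
    (hw : w ∈ ((simpleIto hB).map (LinearMap.fst ℝ _ _))ᗮ) (t : I) :
    ∀ᵐ ω ∂P, inner ℝ (indicatorTime t) (toHilbertValued w ω) = 0 := by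
  have hZ : MemLp (fun ω ↦ inner ℝ (indicatorTime t) (toHilbertValued w ω)) 2 P :=
    (Lp.memLp (toHilbertValued w)).const_inner _
  have hint := integrable_mul_inner_indicatorInterval w t
  have key : ∫ ω, inner ℝ (indicatorTime t) (toHilbertValued w ω) ^ 2 ∂P = 0 := by
    have e1 : ∫ ω, inner ℝ (indicatorTime t) (toHilbertValued w ω) ^ 2 ∂P =
        ∫ ω, 2 * (∫ r in Set.Iic t, w (ω, r) *
          inner ℝ (indicatorInterval r t) (toHilbertValued w ω)) ∂P := by
      refine integral_congr_ae ?_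
      filter_upwards [toHilbertValued_ae w] with ω hω
      rw [inner_indicatorTime_sq]
      congr 1
      refine integral_congr_ae (ae_restrict_of_ae ?_)
      filter_upwards [hω] with r hr
      rw [hr]
    rw [e1, integral_const_mul, integral_integral_swap]
    · refine mul_eq_zero_of_right _ (setIntegral_eq_zero_of_ae_eq_zero ?_)
      have hsq := (Lp.memLp w).integrable_sq.prod_left_ae
      have hm := (Lp.stronglyMeasurable w)
      filter_upwards [hwa, hsq] with r h1 h2 hr
      -- Adaptedness enters here: for almost every r, the slice w(·,r) is itself an admissible
      -- multiplier Y at time r.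
      exact integral_mul_inner_eq_zero_of_orthogonal hw hr h1
        ((memLp_two_iff_integrable_sq
          (hm.comp_measurable measurable_prodMk_right).aestronglyMeasurable).2 h2)
    · refine hint.mono_measure ?_
      exact Measure.prod_mono le_rfl Measure.restrict_le_self
  rw [integral_eq_zero_iff_of_nonneg (fun ω ↦ sq_nonneg _) hZ.integrable_sq] at key
  filter_upwards [key] with ω hω
  exact pow_eq_zero_iff two_ne_zero |>.1 hω

theorem eq_zero_of_orthogonal_simpleIto {hB : IsBrownianMotion B P}
    {w : Lp ℝ 2 (P.prod (volume : Measure I))} (hwa : IsAEAdapted hB w)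
    (hw : w ∈ ((simpleIto hB).map (LinearMap.fst ℝ _ _))ᗮ) : w = 0 := by
  have hspan : ∀ c ∈ Submodule.span ℝ (Set.range indicatorTime),
      ∀ᵐ ω ∂P, inner ℝ c (toHilbertValued w ω) = 0 := by
    intro c hc
    induction hc using Submodule.span_induction with
    | mem c hc =>
      obtain ⟨t, rfl⟩ := hc
      exact inner_indicatorTime_ae_eq_zero hwa hw t
    | zero => simp
    | add c d _ _ hc hd =>
      filter_upwards [hc, hd] with ω h1 h2
      rw [inner_add_left, h1, h2, add_zero]
    | smul a c _ hc =>
      filter_upwards [hc] with ω h1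
      rw [real_inner_smul_left, h1, mul_zero]
  have hU : toHilbertValued w = 0 := by
    rw [Lp.eq_zero_iff_ae_eq_zero]
    refine ae_eq_zero_of_forall_inner (𝕜 := ℝ) fun c ↦ ?_
    have hc : c ∈ (Submodule.span ℝ (Set.range indicatorTime)).topologicalClosure := by
      rw [topologicalClosure_span_indicatorTime]
      trivial
    rw [← SetLike.mem_coe, Submodule.topologicalClosure_coe] at hc
    -- The exceptional null set depends on c, so c is approached along a sequence, for which
    -- countably many null sets suffice.
    obtain ⟨cn, hcn, hlim⟩ := mem_closure_iff_seq_limit.1 hc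
    filter_upwards [ae_all_iff.2 fun n ↦ hspan (cn n) (hcn n)] with ω hω
    refine tendsto_nhds_unique (hlim.inner tendsto_const_nhds) ?_
    simp only [hω]
    exact tendsto_const_nhds
  rw [← norm_eq_zero, ← norm_toHilbertValued, hU, norm_zero]

/-- Project u onto the closure. The projection is a limit of simple processes and so remains adapted
up to null sets; the residual is then adapted and orthogonal, hence zero. -/
theorem mem_closure_simpleIto_of_isAEAdapted {hB : IsBrownianMotion B P}
    {u : Lp ℝ 2 (P.prod (volume : Measure I))} (hu : IsAEAdapted hB u) :
    u ∈ ((simpleIto hB).map (LinearMap.fst ℝ _ _)).topologicalClosure := by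
  set K := ((simpleIto hB).map (LinearMap.fst ℝ (Lp ℝ 2 (P.prod (volume : Measure I)))
    (Lp ℝ 2 P))) with hK
  have : CompleteSpace K.topologicalClosure :=
    K.isClosed_topologicalClosure.completeSpace_coe
  set e : Lp ℝ 2 (P.prod (volume : Measure I)) := K.topologicalClosure.starProjection u
  have he : e ∈ K.topologicalClosure := Submodule.starProjection_apply_mem _ _
  have hw : u - e ∈ K.topologicalClosureᗮ := Submodule.sub_starProjection_mem_orthogonal u
  have h0 : u - e = 0 := eq_zero_of_orthogonal_simpleIto
    (hu.sub (isAEAdapted_of_mem_closure he)) (K.orthogonal_closure ▸ hw)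
  rwa [sub_eq_zero.1 h0]

end Density

theorem exists_isItoIntegral {Ω : Type*} [mΩ : MeasurableSpace Ω] {P : Measure Ω}
    [IsProbabilityMeasure P] {B : I → Ω → ℝ} {hB : IsBrownianMotion B P}
    {u : Lp ℝ 2 (P.prod (volume : Measure I))} (hu : u ∈ adaptedL2 hB) :
    ∃ X, IsItoIntegral hB u X :=
  exists_isItoIntegral_of_mem_closure
    (mem_closure_simpleIto_of_isAEAdapted (isAEAdapted_of_mem_adaptedL2 hu))

end Skorokhod

end

theorem mainTheorem9 {Ω : Type*} [mΩ : MeasurableSpace Ω] (P : Measure Ω) [IsProbabilityMeasure P]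
    (B : I → Ω → ℝ) (hB : Skorokhod.IsBrownianMotion B P)
    (hF : Skorokhod.brownianFiltration hB 1 = mΩ) :
    (∀ u ∈ Skorokhod.adaptedL2 hB,
      Skorokhod.toHilbertValued u ∈
        (Skorokhod.divergence (Skorokhod.wienerIntegral hB)).domain) ∧
    (∀ u ∈ Skorokhod.adaptedL2 hB,
      ∀ hu : Skorokhod.toHilbertValued u ∈
        (Skorokhod.divergence (Skorokhod.wienerIntegral hB)).domain,
      ∀ X : Lp ℝ 2 P, Skorokhod.IsItoIntegral hB u X ↔
        X = Skorokhod.divergence (Skorokhod.wienerIntegral hB)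
          ⟨Skorokhod.toHilbertValued u, hu⟩) := by
  have hW := Skorokhod.isIsonormal_wienerIntegral hB
  have hT := Skorokhod.isTotal_wienerIntegral hB hF
  refine ⟨fun u hu ↦ ?_, fun u hu hU X ↦ ⟨fun hX ↦ ?_, ?_⟩⟩
  · obtain ⟨X, hX⟩ := Skorokhod.exists_isItoIntegral hu
    exact Skorokhod.mem_divergence_domain hW hT fun F G h ↦ hX.inner_eq h
  · exact (Skorokhod.divergence_eq hW hT (fun F G h ↦ hX.inner_eq h) hU).symm
  · rintro rfl
    -- Some Itô integral exists, and duality forces it to be δ(u).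
    obtain ⟨X, hX⟩ := Skorokhod.exists_isItoIntegral hu
    rwa [Skorokhod.divergence_eq hW hT (fun F G h ↦ hX.inner_eq h) hU]
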